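/- **Setting.** Let $g(t)=2^{1/4}e^{-\pi t^2}$, $M_vT_ug(t)=e^{2\pi i v t}g(t-u)$, and let $h_k$ ($k\ge 0$) be the $L^2$-normalized Hermite functions $$h_k(x)=\frac{(-1)^k\,2^{1/4}}{2^k\pi^{k/2}\sqrt{k!}}\;e^{\pi x^2}\frac{d^k}{dx^k}e^{-2\pi x^2}.$$ For a tempered distribution $y\in\mathcal S'(\mathbb R)$ let $V_gy(u,v)=\langle y,M_vT_ug\rangle:=y\big(\overline{M_vT_ug}\big)$ be its Gabor transform; for a function $f$ this is $\int f\,\overline{M_vT_ug}$. Let $\mu_1$ be the law on $\mathcal S'(\mathbb R)$ of real Gaussian white noise $\xi$: for every real Schwartz function $\phi$, $\langle\xi,\phi\rangle$ is almost surely real and $\mathbb E\,e^{i\langle\xi,\phi\rangle}=e^{-\|\phi\|_{L^2}^2/2}$. For $L>0$ let $\mathbb B_L=\{u+iv:\max(|u|,|v|)\le L\}$ and $\Lambda(\theta)=\{u+iv\in\mathbb B_L: |V_gy(u,v)|\ge\theta\}$. Let $\hat\theta=\max\{\theta\ge 0:\Lambda(\theta)\ne\emptyset\}$, and let $\hat k$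 be the nearest integer to $\pi\,(\min\{|z|:z\in\Lambda(\hat\theta)\})^2$. For $k_0\ge 1$ put $$\mathfrak M(k_0)=\min_{1\le k\le k_0}\max_{u,v\in\mathbb R}|V_gh_k(u,v)|,\qquad C(k,r)=\frac{(1+r)^k}{e^{k(r+r^2/2)}},$$ $$\beta(k)=\max\Big\{C\big(k,\tfrac1{4k+2}\big),\,C\big(k,-\tfrac1{4k+2}\big)\Big\},\qquad C(k_0)=\frac{2}{5\,(1-\max_{1\le k\le k_0}\beta(k))}+1 .$$ **Theorem.** There is a universal constant $K>0$ such that, for every $0<\sigma\le\sqrt\pi$ (in particular for $\sigma=1$), the following two statements hold. (i) For all $L\ge\pi$ and $\tau>0$, $$\mathbb P\Big[\sup_{u+iv\in\mathbb B_L}|V_g(\sigma\xi)(u,v)|\le\sqrt2\,(14K+\tau)\sqrt{\log L}\Big]\ \ge\ 1-4\exp\Big(-\frac{\tau^2}{2\pi}\log L\Big).$$ (ii) Let $k_0\ge1$ be an integer, $\tau>0$, $L\ge\max\{\sqrt{k_0/\pi},\,\pi\}$, and let $\lambda\in\mathbb R$ satisfy $$|\lambda|\ \ge\ 5\,C(k_0)\sqrt2\,(14K+\tau)\,\mathfrak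 M(k_0)^{-1}\sqrt{\log L}.$$ Write $\mathbb P_k$ for the probability when the observation is $y=\lambda h_k+\sigma\xi$. Then $$\inf_{1\le k\le k_0}\mathbb P_k[\hat k=k]\ \ge\ 1-4\exp\Big(-\frac{\tau^2}{2\pi}\log L\Big),$$ where the event $\hat k=k$ includes that the maximum and the minimum defining $\hat\theta$ and $\hat k$ are attained. -/

import Mathlib

open MeasureTheory
open scoped SchwartzMap

noncomputable section

/-! ### Helper facts: a polynomial times a Gaussian is a Schwartz function -/

/-- The function `x ↦ P(x) exp(-πx² + bx)`. -/
def polyGauss (P : Polynomial ℂ) (b : ℂ) (x : ℝ) : ℂ :=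
  P.eval (x : ℂ) * Complex.exp (-(Real.pi : ℂ) * (x : ℂ) ^ 2 + b * x)

theorem polyGauss_contDiff (P : Polynomial ℂ) (b : ℂ) (n : WithTop ℕ∞) :
    ContDiff ℝ n (polyGauss P b) := by
  have h1 : ContDiff ℝ n (fun x : ℝ => (x : ℂ)) := Complex.ofRealCLM.contDiff
  have h2 : ContDiff ℝ n (fun x : ℝ => P.eval (x : ℂ)) := by
    have : ContDiff ℂ n (fun z : ℂ => P.eval z) := by
      simpa [Polynomial.aeval_def] using P.contDiff_aeval (𝕜 := ℂ) n
    exact (this.restrict_scalars ℝ).comp h1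
  exact h2.mul (((contDiff_const.mul (h1.pow 2)).add (contDiff_const.mul h1)).cexp)

/-- The polynomial factor of the derivative of `polyGauss P b`. -/
def polyGaussStep (b : ℂ) (P : Polynomial ℂ) : Polynomial ℂ :=
  P.derivative + P * (Polynomial.C b - Polynomial.C (2 * (Real.pi : ℂ)) * Polynomial.X)

theorem polyGauss_deriv (P : Polynomial ℂ) (b : ℂ) :
    deriv (polyGauss P b) = polyGauss (polyGaussStep b P) b := by
  funext x
  have h1 : HasDerivAt (fun z : ℂ => P.eval z *
      Complex.exp (-(Real.pi : ℂ) * z ^ 2 + b * z)) _ (x : ℂ) :=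
    (P.hasDerivAt (x : ℂ)).mul
      ((((hasDerivAt_pow 2 (x : ℂ)).const_mul (-(Real.pi : ℂ))).add
        ((hasDerivAt_id (x : ℂ)).const_mul b)).cexp)
  have h2 := h1.comp_ofReal
  have h3 : deriv (polyGauss P b) x = _ := h2.deriv
  rw [h3]
  simp [polyGauss, polyGaussStep]
  ring

theorem polyGauss_iteratedDeriv (b : ℂ) (n : ℕ) (P : Polynomial ℂ) :
    iteratedDeriv n (polyGauss P b) = polyGauss ((polyGaussStep b)^[n] P) b := by
  induction n generalizing P with
  | zero => simp
  | succ n ih => rw [iteratedDeriv_succ', polyGauss_deriv, ih, Function.iterate_succ_apply]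

theorem pow_mul_gauss_le (c : ℝ) (m : ℕ) (x : ℝ) :
    |x| ^ m * Real.exp (-Real.pi * x ^ 2 + c * x) ≤ m.factorial * Real.exp ((1 + |c|) ^ 2) := by
  have h1 : |x| ^ m ≤ m.factorial * Real.exp |x| := by
    have := Real.pow_div_factorial_le_exp |x| (abs_nonneg x) m
    rw [div_le_iff₀ (by positivity)] at this
    linarith
  have h2 : |x| + (-Real.pi * x ^ 2 + c * x) ≤ (1 + |c|) ^ 2 := by
    have h3 : c * x ≤ |c| * |x| := by rw [← abs_mul]; exact le_abs_self _
    have h4 : x ^ 2 ≤ Real.pi * x ^ 2 := by nlinarith [Real.pi_gt_three, sq_nonneg x]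
    have h5 : x ^ 2 = |x| ^ 2 := (sq_abs x).symm
    nlinarith [sq_nonneg (|x| - (1 + |c|)), sq_nonneg (1 + |c|), abs_nonneg x,
      sq_nonneg |x|, sq_nonneg (|x| - (1 + |c|) / 2)]
  calc |x| ^ m * Real.exp (-Real.pi * x ^ 2 + c * x)
      ≤ (m.factorial * Real.exp |x|) * Real.exp (-Real.pi * x ^ 2 + c * x) := by gcongr
    _ = m.factorial * Real.exp (|x| + (-Real.pi * x ^ 2 + c * x)) := by
        rw [mul_assoc, ← Real.exp_add]
    _ ≤ _ := by gcongr

theorem polyGauss_decay (k : ℕ) (P : Polynomial ℂ) (b : ℂ) :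
    ∃ C : ℝ, ∀ x : ℝ, ‖x‖ ^ k * ‖polyGauss P b x‖ ≤ C := by
  refine ⟨∑ i ∈ Finset.range (P.natDegree + 1),
    ‖P.coeff i‖ * ((k + i).factorial * Real.exp ((1 + |b.re|) ^ 2)), fun x => ?_⟩
  have h1 : ‖polyGauss P b x‖ ≤ (∑ i ∈ Finset.range (P.natDegree + 1), ‖P.coeff i‖ * |x| ^ i) *
      Real.exp (-Real.pi * x ^ 2 + b.re * x) := by
    rw [polyGauss, norm_mul, Complex.norm_exp, Polynomial.eval_eq_sum_range]
    have e : (-(Real.pi : ℂ) * (x : ℂ) ^ 2 + b * x).re = -Real.pi * x ^ 2 + b.re * x := by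
      simp [← Complex.ofReal_pow]
    rw [e]
    gcongr
    refine (norm_sum_le _ _).trans (le_of_eq ?_)
    simp
  calc ‖x‖ ^ k * ‖polyGauss P b x‖
      ≤ |x| ^ k * ((∑ i ∈ Finset.range (P.natDegree + 1), ‖P.coeff i‖ * |x| ^ i) *
        Real.exp (-Real.pi * x ^ 2 + b.re * x)) := by
        rw [Real.norm_eq_abs]; gcongr
    _ = ∑ i ∈ Finset.range (P.natDegree + 1), ‖P.coeff i‖ *
        (|x| ^ (k + i) * Real.exp (-Real.pi * x ^ 2 + b.re * x)) := by
        rw [Finset.sum_mul, Finset.mul_sum]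
        refine Finset.sum_congr rfl fun i _ => ?_
        rw [pow_add]; ring
    _ ≤ _ := by
        exact Finset.sum_le_sum fun i _ =>
          mul_le_mul_of_nonneg_left (pow_mul_gauss_le _ _ _) (norm_nonneg _)

theorem polyGauss_schwartz_decay (P : Polynomial ℂ) (b : ℂ) (k n : ℕ) :
    ∃ C : ℝ, ∀ x : ℝ, ‖x‖ ^ k * ‖iteratedFDeriv ℝ n (polyGauss P b) x‖ ≤ C := by
  obtain ⟨C, hC⟩ := polyGauss_decay k ((polyGaussStep b)^[n] P) b
  refine ⟨C, fun x => ?_⟩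
  rw [norm_iteratedFDeriv_eq_norm_iteratedDeriv, polyGauss_iteratedDeriv]
  exact hC x

/-! ### The Gabor transform -/

/-- The Gaussian window `g(t) = 2^{1/4} exp(-π t²)`, of unit `L²` norm. -/
def gaussWindow (t : ℝ) : ℝ := (2 : ℝ) ^ (1 / 4 : ℝ) * Real.exp (-Real.pi * t ^ 2)

/-- The time-frequency shifted window `(M_v T_u g)(t) = exp(2πivt) g(t - u)`. -/
def gaborAtom (u v t : ℝ) : ℂ :=
  Complex.exp (2 * Real.pi * Complex.I * v * t) * (gaussWindow (t - u) : ℂ)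

theorem conj_gaborAtom_eq (u v : ℝ) :
    (fun t => (starRingEnd ℂ) (gaborAtom u v t)) =
      polyGauss (Polynomial.C (((2 : ℝ) ^ (1 / 4 : ℝ) * Real.exp (-Real.pi * u ^ 2) : ℝ) : ℂ))
        (2 * Real.pi * u - 2 * Real.pi * Complex.I * v) := by
  funext t
  have h : ∀ a b c d e : ℂ, a + d = b + c → Complex.exp a * (e * Complex.exp d) =
      e * Complex.exp b * Complex.exp c := by
    intro a b c d e habcd
    rw [mul_left_comm, ← Complex.exp_add, habcd, Complex.exp_add, mul_assoc]
  simp only [gaborAtom, gaussWindow, polyGauss, map_mul, ← Complex.exp_conj, Complex.conj_ofReal,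
    Complex.conj_I, map_ofNat, Polynomial.eval_C]
  push_cast
  apply h
  ring

/-- The complex conjugate of `M_v T_u g`, as a Schwartz function. -/
def conjGaborAtom (u v : ℝ) : 𝓢(ℝ, ℂ) where
  toFun t := (starRingEnd ℂ) (gaborAtom u v t)
  smooth' := by rw [conj_gaborAtom_eq]; exact polyGauss_contDiff _ _ _
  decay' k n := by rw [conj_gaborAtom_eq]; exact polyGauss_schwartz_decay _ _ k n

/-- The Gabor transform `V_g y(u,v) = ⟨y, M_v T_u g⟩` of a tempered distribution `y`, where the
pairing is conjugate linear in the window, so that it extends the `L²` inner product. -/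
def gabor (y : 𝓢'(ℝ, ℂ)) (u v : ℝ) : ℂ := y (conjGaborAtom u v)

/-- On functions the Gabor transform is `V_g f(u,v) = ∫ f(t) conj((M_v T_u g)(t)) dt`. -/
theorem gabor_coe (f : 𝓢(ℝ, ℂ)) (u v : ℝ) :
    gabor (f : 𝓢'(ℝ, ℂ)) u v = ∫ t : ℝ, f t * (starRingEnd ℂ) (gaborAtom u v t) := by
  rw [gabor, SchwartzMap.coe_apply]
  refine integral_congr_ae (Filter.Eventually.of_forall fun t => ?_)
  exact mul_comm _ _

/-! ### Hermite functions -/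

/-- The `L²`-normalized Hermite function
`h_k(x) = (-1)^k 2^{1/4} / (2^k π^{k/2} √k!) · exp(πx²) · (d/dx)^k exp(-2πx²)`. -/
def hermiteFun (k : ℕ) (x : ℝ) : ℝ :=
  (-1) ^ k * (2 : ℝ) ^ (1 / 4 : ℝ) / (2 ^ k * Real.sqrt (Real.pi ^ k * k.factorial)) *
    Real.exp (Real.pi * x ^ 2) * iteratedDeriv k (fun t : ℝ => Real.exp (-2 * Real.pi * t ^ 2)) x

theorem iteratedDeriv_gauss (k : ℕ) : ∃ P : Polynomial ℝ,
    iteratedDeriv k (fun t : ℝ => Real.exp (-2 * Real.pi * t ^ 2)) =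
      fun x => P.eval x * Real.exp (-2 * Real.pi * x ^ 2) := by
  induction k with
  | zero => exact ⟨1, by simp⟩
  | succ k ih =>
    obtain ⟨P, hP⟩ := ih
    refine ⟨P.derivative - P * (Polynomial.C (4 * Real.pi) * Polynomial.X), ?_⟩
    rw [iteratedDeriv_succ, hP]
    funext x
    have h : HasDerivAt (fun x : ℝ => P.eval x * Real.exp (-2 * Real.pi * x ^ 2)) _ x :=
      (P.hasDerivAt x).mul (((hasDerivAt_pow 2 x).const_mul (-2 * Real.pi)).exp)
    rw [h.deriv]
    simp
    ring

theorem hermiteFun_eq (k : ℕ) : ∃ P : Polynomial ℂ,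
    (fun x => (hermiteFun k x : ℂ)) = polyGauss P 0 := by
  obtain ⟨P, hP⟩ := iteratedDeriv_gauss k
  refine ⟨Polynomial.C ((((-1) ^ k * (2 : ℝ) ^ (1 / 4 : ℝ) /
    (2 ^ k * Real.sqrt (Real.pi ^ k * k.factorial)) : ℝ)) : ℂ) * P.map Complex.ofRealHom, ?_⟩
  funext x
  have e : Real.exp (Real.pi * x ^ 2) * Real.exp (-2 * Real.pi * x ^ 2) =
      Real.exp (-Real.pi * x ^ 2) := by
    rw [← Real.exp_add]; congr 1; ring
  have h : hermiteFun k x = ((-1) ^ k * (2 : ℝ) ^ (1 / 4 : ℝ) /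
      (2 ^ k * Real.sqrt (Real.pi ^ k * k.factorial))) * P.eval x *
        Real.exp (-Real.pi * x ^ 2) := by
    rw [hermiteFun, hP, ← e]; ring
  have e2 : (P.map Complex.ofRealHom).eval (x : ℂ) = ((P.eval x : ℝ) : ℂ) :=
    Polynomial.eval_map_apply (f := Complex.ofRealHom) x
  rw [h, polyGauss, Polynomial.eval_mul, Polynomial.eval_C, e2]
  push_cast
  simp

/-- The Hermite function `h_k` as a Schwartz function. -/
def hermiteS (k : ℕ) : 𝓢(ℝ, ℂ) where
  toFun x := (hermiteFun k x : ℂ)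
  smooth' := by obtain ⟨P, hP⟩ := hermiteFun_eq k; rw [hP]; exact polyGauss_contDiff _ _ _
  decay' m n := by
    obtain ⟨P, hP⟩ := hermiteFun_eq k; rw [hP]; exact polyGauss_schwartz_decay _ _ m n

/-! ### White noise -/

/-- The Borel sigma-algebra of the space of tempered distributions. -/
instance temperedMeasurableSpace : MeasurableSpace 𝓢'(ℝ, ℂ) := borel _

instance temperedBorelSpace : BorelSpace 𝓢'(ℝ, ℂ) := ⟨rfl⟩

/-- `μ` is the law of real Gaussian white noise: for every real-valued Schwartz function `φ`,
`⟨ξ, φ⟩` is almost surely real and `𝔼 exp(i⟨ξ, φ⟩) = exp(-‖φ‖² / 2)`. -/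
structure IsWhiteNoise (μ : Measure 𝓢'(ℝ, ℂ)) : Prop where
  isReal : ∀ φ : 𝓢(ℝ, ℂ), (∀ x, (φ x).im = 0) → ∀ᵐ ξ ∂μ, (ξ φ).im = 0
  charFun : ∀ φ : 𝓢(ℝ, ℂ), (∀ x, (φ x).im = 0) →
    ∫ ξ, Complex.exp (Complex.I * ξ φ) ∂μ =
      ((Real.exp (-(1 / 2) * ∫ x : ℝ, ‖φ x‖ ^ 2) : ℝ) : ℂ)

/-! ### Level sets and the estimator of the mode -/

/-- The square `B_L = {u + iv : max(|u|, |v|) ≤ L}`. -/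
def box (L : ℝ) : Set ℂ := {z | max |z.re| |z.im| ≤ L}

/-- The spectrogram level set `Λ(θ)` of `y`, restricted to `B_L`. -/
def levelSet (L : ℝ) (y : 𝓢'(ℝ, ℂ)) (θ : ℝ) : Set ℂ :=
  {z | z ∈ box L ∧ θ ≤ ‖gabor y z.re z.im‖}

/-- `θ` is `θ̂ = max {θ ≥ 0 : Λ(θ) is nonempty}`. -/
def IsThetaHat (L : ℝ) (y : 𝓢'(ℝ, ℂ)) (θ : ℝ) : Prop :=
  IsGreatest {θ' : ℝ | (levelSet L y θ').Nonempty ∧ 0 ≤ θ'} θ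

/-- `m` is `k̂`, the nearest integer to `π (min {|z| : z ∈ Λ(θ̂)})²`; the maximum defining `θ̂` and
this minimum are required to be attained. -/
def IsKHat (L : ℝ) (y : 𝓢'(ℝ, ℂ)) (m : ℤ) : Prop :=
  ∃ θ r : ℝ, IsThetaHat L y θ ∧ IsLeast ((fun z : ℂ => ‖z‖) '' levelSet L y θ) r ∧
    m = round (Real.pi * r ^ 2)

/-! ### The constants -/

/-- `𝔐(l) = min_{1 ≤ k ≤ l} max_{u,v} |V_g h_k(u,v)|`. -/
def minimaxM (l : ℕ) : ℝ :=
  ⨅ k : Set.Icc 1 l, ⨆ p : ℝ × ℝ, ‖gabor (hermiteS k : 𝓢'(ℝ, ℂ)) p.1 p.2‖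

/-- `C(k,r) = (1+r)^k / exp(k(r + r²/2))`. -/
def decayRatio (k : ℕ) (r : ℝ) : ℝ := (1 + r) ^ k / Real.exp (k * (r + r ^ 2 / 2))

/-- `β(k) = max {C(k, 1/(4k+2)), C(k, -1/(4k+2))}`. -/
def betaConst (k : ℕ) : ℝ :=
  max (decayRatio k (1 / (4 * k + 2))) (decayRatio k (-(1 / (4 * k + 2))))

/-- `C(k₀) = 2 / (5 (1 - max_{1 ≤ k ≤ k₀} β(k))) + 1`. -/
def modeConst (k₀ : ℕ) : ℝ :=
  2 / (5 * (1 - ⨆ k : Set.Icc 1 k₀, betaConst k)) + 1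

end

noncomputable section

/-! ### Holomorphic dependence of a tempered distribution on the Gaussian parameter -/

/-! The constant `K = 1` works, and part (ii) is a deterministic consequence of the event in part
(i).

Noise. For any tempered distribution, the modulus of the Gabor transform is a Gaussian weight times
the modulus of an entire function of `z = u + iv`. The key input is that `ξ (gaussExp b)` is entire
in `b` (`differentiable_apply_gaussExp`). A submean value inequality then bounds `exp (c |V|²)` at a
point by an average of `exp (3/2 c |V|²)` over a disc of radius 1/4 (`exp_sq_gabor_le_lintegral`).
So if `|V_g(σξ)|` exceeds `S` somewhere on `box L`, the integral of `exp (3/8 |V_g ξ|²)` over `box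
(L + 1)` is at least `π/16 · exp (S² / (4π))`. Each value of `V_g ξ` is a unit-norm Gaussian
functional with `E exp (3/8 |V|²) ≤ 2`, so Tonelli and Markov bound the probability by a multiple of
`(L + 1)² exp (-S² / (4π))`. This replaces any chaining or net argument, and the 14 in `S` absorbs
the polynomial factor.

Signal. An exact computation gives `|V_g h_k(z)| = hermitePeak k · C(k, |z|/ρ - 1)` with `ρ =
√(k/π)`. This profile increases up to the circle `|z| = ρ` and decreases beyond it, and wherever
`π|z|²` is at least 1/2 away from `k` it is at most `β(k)` times the peak. If the noise is at most
`S` on the box, the observation is at least `|λ| P - S` on the ridge and at most `|λ| P β + S` far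
from it, where `P` is the peak. The threshold on `|λ|` separates these, so all maximizers satisfy
`|π|z|² - k| < 1/2` and rounding returns `k`. -/

theorem natDegree_polyGaussStep_iterate_le (P : Polynomial ℂ) (b : ℂ) (n : ℕ) :
    ((polyGaussStep b)^[n] P).natDegree ≤ P.natDegree + n := by
  induction n with
  | zero => simp
  | succ n ih =>
    rw [Function.iterate_succ_apply', polyGaussStep]
    refine (Polynomial.natDegree_add_le _ _).trans (max_le ?_ ?_)
    · exact (Polynomial.natDegree_derivative_le _).trans (by omega)
    · refine Polynomial.natDegree_mul_le.trans ?_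
      have : (Polynomial.C b - Polynomial.C (2 * (Real.pi : ℂ)) * Polynomial.X).natDegree ≤ 1 := by
        compute_degree
      omega

/-- `polyGaussStep b` is affine in `b`, so each coefficient of an iterate is a polynomial in `b`. -/
theorem differentiable_coeff_polyGaussStep_iterate (P : Polynomial ℂ) (n i : ℕ) :
    Differentiable ℂ fun b => ((polyGaussStep b)^[n] P).coeff i := by
  induction n generalizing i with
  | zero => simp
  | succ n ih =>
    simp only [Function.iterate_succ_apply', polyGaussStep, mul_sub, Polynomial.coeff_add,
      Polynomial.coeff_sub, Polynomial.coeff_derivative, Polynomial.coeff_mul_C, ← mul_assoc]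
    cases i with
    | zero =>
      simp only [Polynomial.coeff_mul_X_zero]
      exact ((ih _).mul_const _).add (((ih _).mul differentiable_id).sub_const _)
    | succ i =>
      simp only [Polynomial.coeff_mul_X, Polynomial.coeff_mul_C]
      exact ((ih _).mul_const _).add (((ih _).mul differentiable_id).sub ((ih _).mul_const _))

theorem differentiable_polyGauss_iterate (P : Polynomial ℂ) (n : ℕ) (t : ℝ) :
    Differentiable ℂ fun b => polyGauss ((polyGaussStep b)^[n] P) b t := by
  have h : ∀ b, ((polyGaussStep b)^[n] P).eval (t : ℂ) =
      ∑ i ∈ Finset.range (P.natDegree + n + 1), ((polyGaussStep b)^[n] P).coeff i * (t : ℂ) ^ i :=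
    fun b => Polynomial.eval_eq_sum_range'
      (Nat.lt_succ_of_le (natDegree_polyGaussStep_iterate_le P b n)) _
  simp only [polyGauss, h]
  refine Differentiable.mul ?_ (by fun_prop)
  exact Differentiable.fun_sum fun i _ =>
    (differentiable_coeff_polyGaussStep_iterate P n i).mul_const _

theorem pow_mul_norm_polyGauss_le (k N : ℕ) (Q : Polynomial ℂ) (hQ : Q.natDegree < N) (b : ℂ)
    (x : ℝ) : |x| ^ k * ‖polyGauss Q b x‖ ≤ ∑ i ∈ Finset.range N,
      ‖Q.coeff i‖ * ((k + i).factorial * Real.exp ((1 + |b.re|) ^ 2)) := by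
  have h1 : ‖polyGauss Q b x‖ ≤ (∑ i ∈ Finset.range N, ‖Q.coeff i‖ * |x| ^ i) *
      Real.exp (-Real.pi * x ^ 2 + b.re * x) := by
    rw [polyGauss, norm_mul, Complex.norm_exp, Polynomial.eval_eq_sum_range' hQ]
    have e : (-(Real.pi : ℂ) * (x : ℂ) ^ 2 + b * x).re = -Real.pi * x ^ 2 + b.re * x := by
      simp [← Complex.ofReal_pow]
    rw [e]
    gcongr
    refine (norm_sum_le _ _).trans (le_of_eq ?_)
    simp
  calc |x| ^ k * ‖polyGauss Q b x‖
      ≤ |x| ^ k * ((∑ i ∈ Finset.range N, ‖Q.coeff i‖ * |x| ^ i) *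
        Real.exp (-Real.pi * x ^ 2 + b.re * x)) := by gcongr
    _ = ∑ i ∈ Finset.range N, ‖Q.coeff i‖ *
        (|x| ^ (k + i) * Real.exp (-Real.pi * x ^ 2 + b.re * x)) := by
        rw [Finset.sum_mul, Finset.mul_sum]
        refine Finset.sum_congr rfl fun i _ => ?_
        rw [pow_add]; ring
    _ ≤ _ := Finset.sum_le_sum fun i _ =>
          mul_le_mul_of_nonneg_left (pow_mul_gauss_le _ _ _) (norm_nonneg _)

/-- The pointwise bound depends on the parameter only through a continuous function of `c`, which is
bounded on a compact disc; this makes the estimate uniform in both `c` and `x`. -/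
theorem exists_pow_mul_norm_polyGauss_iterate_le (P : Polynomial ℂ) (k n : ℕ) (b : ℂ) (R : ℝ) :
    ∃ C, ∀ c ∈ Metric.closedBall b R, ∀ x : ℝ,
      |x| ^ k * ‖polyGauss ((polyGaussStep c)^[n] P) c x‖ ≤ C := by
  have hc : Continuous fun c : ℂ => ∑ i ∈ Finset.range (P.natDegree + n + 1),
      ‖((polyGaussStep c)^[n] P).coeff i‖ *
        ((k + i).factorial * Real.exp ((1 + |c.re|) ^ 2)) := by
    refine continuous_finsetSum _ fun i _ => ?_
    have := (differentiable_coeff_polyGaussStep_iterate P n i).continuous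
    fun_prop
  obtain ⟨C, hC⟩ := (isCompact_closedBall b R).bddAbove_image hc.continuousOn
  exact ⟨C, fun c hcb x => (pow_mul_norm_polyGauss_le k _ _
    (Nat.lt_succ_of_le (natDegree_polyGaussStep_iterate_le P c n)) c x).trans
      (hC ⟨c, hcb, rfl⟩)⟩

/-- A quantitative form of complex differentiability: the difference quotients of a bounded entire
function approach the derivative at a rate that only depends on the bound. -/
theorem norm_slope_sub_slope_le {f : ℂ → ℂ} (hf : Differentiable ℂ f) {b : ℂ} {M : ℝ}
    (hM : ∀ c ∈ Metric.closedBall b 1, ‖f c‖ ≤ M) {h h' : ℂ} (h0 : h ≠ 0) (h0' : h' ≠ 0)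
    (h1 : ‖h‖ < 1) (h1' : ‖h'‖ < 1) :
    ‖h⁻¹ * (f (b + h) - f b) - h'⁻¹ * (f (b + h') - f b)‖ ≤ 4 * (M + 1) * (‖h‖ + ‖h'‖) := by
  -- The divided difference, completed at `b`, is entire. The maximum principle on the unit disc
  -- bounds it by `2 * M`, and the Schwarz lemma then makes it Lipschitz at `b`.
  have hd : Differentiable ℂ (dslope f b) := by
    rw [← differentiableOn_univ, Complex.differentiableOn_dslope Filter.univ_mem]
    exact hf.differentiableOn
  have hM0 : 0 ≤ M := (norm_nonneg _).trans (hM b (by simp))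
  have hb : ∀ c ∈ Metric.closedBall b 1, ‖dslope f b c‖ ≤ 2 * M := by
    intro c hc
    refine Complex.norm_le_of_forall_mem_frontier_norm_le (U := Metric.ball b 1)
      Metric.isBounded_ball hd.diffContOnCl ?_ ?_
    · intro z hz
      rw [frontier_ball _ one_ne_zero] at hz
      have hz1 : ‖z - b‖ = 1 := by simpa using hz
      have hne : z ≠ b := by rintro rfl; simp at hz1
      rw [dslope_of_ne _ hne, slope_def_module, norm_smul, norm_inv, hz1, inv_one, one_mul]
      have h3 := hM z (Metric.sphere_subset_closedBall hz)
      have h4 := hM b (by simp)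
      linarith [norm_sub_le (f z) (f b)]
    · rwa [closure_ball _ one_ne_zero]
  have key : ∀ k : ℂ, k ≠ 0 → ‖k‖ < 1 →
      ‖k⁻¹ * (f (b + k) - f b) - dslope f b b‖ ≤ 4 * (M + 1) * ‖k‖ := by
    intro k k0 k1
    have hne : b + k ≠ b := by simpa using k0
    have e : k⁻¹ * (f (b + k) - f b) = dslope f b (b + k) := by
      rw [dslope_of_ne _ hne, slope_def_module]; simp
    rw [e, ← dist_eq_norm]
    have hmaps : Set.MapsTo (dslope f b) (Metric.ball b 1)
        (Metric.closedBall (dslope f b b) (4 * (M + 1))) := by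
      intro z hz
      rw [Metric.mem_closedBall, dist_eq_norm]
      have h3 := hb z (Metric.ball_subset_closedBall hz)
      have h4 := hb b (by simp)
      linarith [norm_sub_le (dslope f b z) (dslope f b b)]
    have := Complex.dist_le_div_mul_dist_of_mapsTo_ball (hd.differentiableOn (s := _)) hmaps
      (z := b + k) (by simpa using k1)
    simpa using this
  calc _ = ‖(h⁻¹ * (f (b + h) - f b) - dslope f b b) -
        (h'⁻¹ * (f (b + h') - f b) - dslope f b b)‖ := by congr 1; ring
    _ ≤ _ := (norm_sub_le _ _).trans (by linarith [key h h0 h1, key h' h0' h1'])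

/-- The function `t ↦ exp(-πt² + bt)` as a Schwartz function. -/
def gaussExp (b : ℂ) : 𝓢(ℝ, ℂ) where
  toFun := polyGauss 1 b
  smooth' := polyGauss_contDiff _ _ _
  decay' := polyGauss_schwartz_decay _ _

theorem gaussExp_apply (b : ℂ) (t : ℝ) : gaussExp b t = polyGauss 1 b t := rfl

/-- For fixed `x`, the weighted `n`-th derivative is entire in the parameter, with a bound on the
unit disc independent of `x`. The quantitative slope estimate is therefore uniform in `x`, hence
holds in the seminorm. -/
theorem exists_seminorm_slope_gaussExp_le (b : ℂ) (k n : ℕ) :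
    ∃ C : ℝ, ∀ h h' : ℂ, h ≠ 0 → h' ≠ 0 → ‖h‖ < 1 → ‖h'‖ < 1 →
      SchwartzMap.seminorm ℂ k n (h⁻¹ • (gaussExp (b + h) - gaussExp b) -
        h'⁻¹ • (gaussExp (b + h') - gaussExp b)) ≤ C * (‖h‖ + ‖h'‖) := by
  obtain ⟨M, hM⟩ := exists_pow_mul_norm_polyGauss_iterate_le 1 k n b 1
  have hM0 : 0 ≤ M := by
    refine le_trans ?_ (hM b (by simp) 0)
    positivity
  refine ⟨4 * (M + 1), fun h h' h0 h0' h1 h1' => ?_⟩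
  refine SchwartzMap.seminorm_le_bound' ℂ k n _ (by positivity) fun x => ?_
  set f : ℂ → ℂ := fun c => ((|x| : ℝ) : ℂ) ^ k * polyGauss ((polyGaussStep c)^[n] 1) c x with hf
  have hfd : Differentiable ℂ f := (differentiable_polyGauss_iterate 1 n x).const_mul _
  have hfb : ∀ c ∈ Metric.closedBall b 1, ‖f c‖ ≤ M := by
    intro c hc
    simpa [hf] using hM c hc x
  have hcd : ∀ c, ContDiffAt ℝ n (polyGauss 1 c) x := fun c =>
    (polyGauss_contDiff 1 c n).contDiffAt
  have e : iteratedDeriv n (⇑(h⁻¹ • (gaussExp (b + h) - gaussExp b) -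
        h'⁻¹ • (gaussExp (b + h') - gaussExp b))) x =
      h⁻¹ * (polyGauss ((polyGaussStep (b + h))^[n] 1) (b + h) x -
          polyGauss ((polyGaussStep b)^[n] 1) b x) -
        h'⁻¹ * (polyGauss ((polyGaussStep (b + h'))^[n] 1) (b + h') x -
          polyGauss ((polyGaussStep b)^[n] 1) b x) := by
    have e1 : (⇑(h⁻¹ • (gaussExp (b + h) - gaussExp b) -
        h'⁻¹ • (gaussExp (b + h') - gaussExp b)) : ℝ → ℂ) =
        h⁻¹ • (polyGauss 1 (b + h) - polyGauss 1 b) -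
        h'⁻¹ • (polyGauss 1 (b + h') - polyGauss 1 b) := rfl
    have hsub : ∀ c, ContDiffAt ℝ n (polyGauss 1 c - polyGauss 1 b) x :=
      fun c => (hcd c).sub (hcd b)
    have hsmul : ∀ a c : ℂ, ContDiffAt ℝ n (a • (polyGauss 1 c - polyGauss 1 b)) x :=
      fun a c => (hsub c).const_smul a
    rw [e1, iteratedDeriv_sub (hsmul _ _) (hsmul _ _), iteratedDeriv_const_smul (hsub _),
      iteratedDeriv_const_smul (hsub _), iteratedDeriv_sub (hcd _) (hcd _),
      iteratedDeriv_sub (hcd _) (hcd _)]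
    simp only [polyGauss_iteratedDeriv, smul_eq_mul]
  have := norm_slope_sub_slope_le hfd hfb h0 h0' h1 h1'
  refine le_trans (le_of_eq ?_) this
  rw [e]
  have e2 : |x| ^ k = ‖((|x| : ℝ) : ℂ) ^ k‖ := by simp
  rw [e2, ← norm_mul]
  congr 1
  simp only [hf]
  ring

theorem exists_seminorm_bound (ξ : 𝓢'(ℝ, ℂ)) : ∃ (s : Finset (ℕ × ℕ)) (C : ℝ), 0 ≤ C ∧
    ∀ φ : 𝓢(ℝ, ℂ), ‖ξ φ‖ ≤ C * ∑ i ∈ s, SchwartzMap.seminorm ℂ i.1 i.2 φ := by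
  have hc : Continuous fun φ : 𝓢(ℝ, ℂ) => ξ φ := map_continuous ξ
  obtain ⟨s, C, -, hC⟩ := Seminorm.bound_of_continuous (schwartz_withSeminorms ℂ ℝ ℂ)
    ((normSeminorm ℂ ℂ).comp (ξ : 𝓢(ℝ, ℂ) →ₗ[ℂ] ℂ)) (by exact hc.norm)
  refine ⟨s, C, C.2, fun φ => (hC φ).trans ?_⟩
  refine mul_le_mul_of_nonneg_left ?_ C.2
  have := Seminorm.finset_sup_le_sum (schwartzSeminormFamily ℂ ℝ ℂ) s φ
  simpa [schwartzSeminormFamily] using this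

/-- A tempered distribution is controlled by finitely many seminorms, so the difference quotients of
`ξ (gaussExp b)` are Cauchy. Completeness of `ℂ` supplies the derivative, with no need to identify a
limit in the Schwartz space. -/
theorem differentiable_apply_gaussExp (ξ : 𝓢'(ℝ, ℂ)) :
    Differentiable ℂ fun b => ξ (gaussExp b) := by
  intro b
  obtain ⟨s, C, hC0, hC⟩ := exists_seminorm_bound ξ
  choose D hD using fun i : ℕ × ℕ => exists_seminorm_slope_gaussExp_le b i.1 i.2
  set q : ℂ → ℂ := fun h => h⁻¹ • (ξ (gaussExp (b + h)) - ξ (gaussExp b)) with hq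
  have hqb : ∀ h h' : ℂ, h ≠ 0 → h' ≠ 0 → ‖h‖ < 1 → ‖h'‖ < 1 →
      dist (q h) (q h') ≤ (C * ∑ i ∈ s, D i) * (‖h‖ + ‖h'‖) := by
    intro h h' h0 h0' h1 h1'
    have e : q h - q h' = ξ (h⁻¹ • (gaussExp (b + h) - gaussExp b) -
        h'⁻¹ • (gaussExp (b + h') - gaussExp b)) := by
      simp [hq, map_sub, map_smul]
    rw [dist_eq_norm, e, mul_assoc, Finset.sum_mul]
    refine (hC _).trans (mul_le_mul_of_nonneg_left ?_ hC0)
    exact Finset.sum_le_sum fun i _ => hD i h h' h0 h0' h1 h1'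
  have hcau : Cauchy (Filter.map q (nhdsWithin 0 {0}ᶜ)) := by
    rw [Metric.cauchy_iff]
    refine ⟨inferInstance, fun ε hε => ?_⟩
    set B := C * ∑ i ∈ s, D i
    set δ := min (1 / 2) (ε / (4 * (|B| + 1)))
    have hδ : 0 < δ := by positivity
    have hδ1 : δ ≤ 1 / 2 := min_le_left _ _
    have hδ2 : δ * (4 * (|B| + 1)) ≤ ε := by
      rw [← le_div_iff₀ (by positivity)]; exact min_le_right _ _
    refine ⟨q '' (Metric.ball 0 δ ∩ {0}ᶜ), Filter.image_mem_map
      (Filter.inter_mem (mem_nhdsWithin_of_mem_nhds (Metric.ball_mem_nhds _ hδ))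
        self_mem_nhdsWithin), ?_⟩
    rintro _ ⟨h, ⟨hh, h0⟩, rfl⟩ _ ⟨h', ⟨hh', h0'⟩, rfl⟩
    rw [mem_ball_zero_iff] at hh hh'
    refine (hqb h h' h0 h0' (by linarith) (by linarith)).trans_lt ?_
    have : B * (‖h‖ + ‖h'‖) ≤ |B| * (2 * δ) := by
      refine (mul_le_mul_of_nonneg_right (le_abs_self B) (by positivity)).trans ?_
      gcongr
      linarith
    nlinarith [abs_nonneg B]
  obtain ⟨l, hl⟩ := CompleteSpace.complete hcau
  have : HasDerivAt (fun b => ξ (gaussExp b)) l b := by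
    rw [hasDerivAt_iff_tendsto_slope_zero]
    exact hl
  exact this.differentiableAt

theorem conjGaborAtom_eq_smul (u v : ℝ) : conjGaborAtom u v =
    (((2 : ℝ) ^ (1 / 4 : ℝ) * Real.exp (-Real.pi * u ^ 2) : ℝ) : ℂ) •
      gaussExp (2 * Real.pi * (starRingEnd ℂ) (⟨u, v⟩ : ℂ)) := by
  ext t
  have h1 : conjGaborAtom u v t = polyGauss (Polynomial.C
      (((2 : ℝ) ^ (1 / 4 : ℝ) * Real.exp (-Real.pi * u ^ 2) : ℝ) : ℂ))
        (2 * Real.pi * u - 2 * Real.pi * Complex.I * v) t :=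
    congrFun (conj_gaborAtom_eq u v) t
  have h2 : (2 * Real.pi * u - 2 * Real.pi * Complex.I * v : ℂ) =
      2 * Real.pi * (starRingEnd ℂ) (⟨u, v⟩ : ℂ) := by
    apply Complex.ext <;> simp
  rw [h1, h2, smul_apply, gaussExp_apply]
  simp [polyGauss]

theorem gabor_eq (ξ : 𝓢'(ℝ, ℂ)) (u v : ℝ) : gabor ξ u v =
    (((2 : ℝ) ^ (1 / 4 : ℝ) * Real.exp (-Real.pi * u ^ 2) : ℝ) : ℂ) *
      ξ (gaussExp (2 * Real.pi * (starRingEnd ℂ) (⟨u, v⟩ : ℂ))) := by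
  rw [gabor, conjGaborAtom_eq_smul, map_smul, smul_eq_mul]

theorem continuous_gabor (ξ : 𝓢'(ℝ, ℂ)) : Continuous fun z : ℂ => gabor ξ z.re z.im := by
  have h1 : Continuous fun z : ℂ => ξ (gaussExp (2 * Real.pi * (starRingEnd ℂ) z)) :=
    (differentiable_apply_gaussExp ξ).continuous.comp
      (continuous_const.mul Complex.continuous_conj)
  simp only [gabor_eq, Complex.eta]
  refine Continuous.mul ?_ h1
  fun_prop

/-! ### A submean value inequality for the Gabor transform -/

/-- The mean value property, with the angle shifted to `(-π, π)` to match the polar coordinate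
chart. -/
theorem enorm_le_lintegral_circle {A : ℂ → ℂ} (hA : Differentiable ℂ A) (ρ : ℝ) :
    ENNReal.ofReal (2 * Real.pi) * ‖A 0‖ₑ ≤
      ∫⁻ θ in Set.Ioo (-Real.pi) Real.pi, ‖A (ρ * (Real.cos θ + Real.sin θ * Complex.I))‖ₑ := by
  have h1 : Real.circleAverage A 0 ρ = A 0 := hA.diffContOnCl.circleAverage
  rw [Real.circleAverage_eq_integral_add (-Real.pi),
    intervalIntegral.integral_comp_add_right (fun θ => A (circleMap 0 ρ θ))] at h1
  have h2 : ((2 * Real.pi : ℝ) : ℂ) * A 0 =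
      ∫ θ in (-Real.pi)..Real.pi, A (ρ * (Real.cos θ + Real.sin θ * Complex.I)) := by
    rw [← h1, Complex.real_smul, ← mul_assoc, ← Complex.ofReal_mul,
      mul_inv_cancel₀ (by positivity), Complex.ofReal_one, one_mul, zero_add,
      show 2 * Real.pi + -Real.pi = Real.pi by ring]
    refine intervalIntegral.integral_congr fun θ _ => ?_
    simp only [circleMap, zero_add, Complex.exp_mul_I, Complex.ofReal_cos, Complex.ofReal_sin]
  have h3 : ENNReal.ofReal (2 * Real.pi) * ‖A 0‖ₑ = ‖((2 * Real.pi : ℝ) : ℂ) * A 0‖ₑ := by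
    rw [enorm_mul]
    congr 1
    rw [← ofReal_norm, Complex.norm_real, Real.norm_of_nonneg (by positivity)]
  rw [h3, h2, intervalIntegral.integral_of_le (by linarith [Real.pi_pos]),
    integral_Ioc_eq_integral_Ioo]
  exact enorm_integral_le_lintegral_enorm _

/-- The submean value inequality on a disc for the modulus of an entire function. -/
theorem enorm_le_lintegral_ball_zero {A : ℂ → ℂ} (hA : Differentiable ℂ A) {r : ℝ} (hr : 0 ≤ r) :
    ENNReal.ofReal (Real.pi * r ^ 2) * ‖A 0‖ₑ ≤ ∫⁻ z in Metric.ball 0 r, ‖A z‖ₑ := by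
  have hAm : Measurable fun z => ‖A z‖ₑ := hA.continuous.measurable.enorm
  rw [← lintegral_indicator Metric.isOpen_ball.measurableSet,
    ← Complex.lintegral_comp_polarCoord_symm, polarCoord_target, Measure.volume_eq_prod,
    ← Measure.prod_restrict, lintegral_prod]
  · calc ENNReal.ofReal (Real.pi * r ^ 2) * ‖A 0‖ₑ
        = ∫⁻ ρ in Set.Ioo 0 r, ENNReal.ofReal ρ * (ENNReal.ofReal (2 * Real.pi) * ‖A 0‖ₑ) := by
          rw [lintegral_mul_const _ (by fun_prop), ← ofReal_integral_eq_lintegral_ofReal,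
            ← integral_Ioc_eq_integral_Ioo, ← intervalIntegral.integral_of_le hr, integral_id,
            ← mul_assoc, ← ENNReal.ofReal_mul (by nlinarith [sq_nonneg r])]
          · congr 2; ring
          · exact (continuous_id.integrableOn_Icc).mono_set Set.Ioo_subset_Icc_self
          · exact (ae_restrict_mem measurableSet_Ioo).mono fun x hx => hx.1.le
      _ ≤ ∫⁻ ρ in Set.Ioo 0 r, ∫⁻ θ in Set.Ioo (-Real.pi) Real.pi, ENNReal.ofReal ρ •
            (Metric.ball (0 : ℂ) r).indicator (fun z => ‖A z‖ₑ)
              (Complex.polarCoord.symm (ρ, θ)) := by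
          refine setLIntegral_mono' measurableSet_Ioo fun ρ hρ => ?_
          have hin : ∀ θ : ℝ, Complex.polarCoord.symm (ρ, θ) ∈ Metric.ball (0 : ℂ) r := by
            intro θ
            rw [mem_ball_zero_iff, Complex.norm_polarCoord_symm, abs_of_pos hρ.1]
            exact hρ.2
          simp only [Set.indicator_of_mem (hin _), smul_eq_mul]
          rw [lintegral_const_mul']
          · gcongr
            simpa using enorm_le_lintegral_circle hA ρ
          · exact ENNReal.ofReal_ne_top
      _ ≤ _ := lintegral_mono_set Set.Ioo_subset_Ioi_self
  · refine Measurable.aemeasurable ?_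
    refine Measurable.smul measurable_fst.ennreal_ofReal ?_
    refine (hAm.indicator Metric.isOpen_ball.measurableSet).comp ?_
    have : Continuous fun p : ℝ × ℝ => Complex.polarCoord.symm p := by
      simp only [Complex.polarCoord_symm_apply]
      fun_prop
    exact this.measurable

theorem enorm_le_lintegral_ball {A : ℂ → ℂ} (hA : Differentiable ℂ A) (c : ℂ) {r : ℝ}
    (hr : 0 ≤ r) :
    ENNReal.ofReal (Real.pi * r ^ 2) * ‖A c‖ₑ ≤ ∫⁻ z in Metric.ball c r, ‖A z‖ₑ := by
  have h := enorm_le_lintegral_ball_zero (A := fun z => A (c + z)) (by fun_prop) hr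
  have h2 := (measurePreserving_add_left (volume : Measure ℂ) c).setLIntegral_comp_preimage
    (Metric.isOpen_ball (x := c) (ε := r)).measurableSet
    (f := fun z => ‖A z‖ₑ) hA.continuous.measurable.enorm
  have h3 : (fun z => c + z) ⁻¹' Metric.ball c r = Metric.ball 0 r := by
    ext z; simp
  rw [h3] at h2
  rw [← h2]
  simpa using h

/-- Conjugating a function holomorphic in `conj z` makes it entire, and an exponential of a
quadratic polynomial recentres the weight at `z₀`, where it equals 1. -/
theorem exists_entire_norm_eq_gabor (ξ : 𝓢'(ℝ, ℂ)) (z₀ : ℂ) :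
    ∃ H : ℂ → ℂ, Differentiable ℂ H ∧ ∀ z, ‖H z‖ =
      ‖gabor ξ z.re z.im‖ * Real.exp (Real.pi / 2 * ‖z - z₀‖ ^ 2) := by
  have hF : Differentiable ℂ fun w => ξ (gaussExp (2 * Real.pi * w)) :=
    (differentiable_apply_gaussExp ξ).comp (differentiable_id.const_mul _)
  refine ⟨fun z => (((2 : ℝ) ^ (1 / 4 : ℝ) : ℝ) : ℂ) *
    (starRingEnd ℂ) (ξ (gaussExp (2 * Real.pi * (starRingEnd ℂ) z))) *
    Complex.exp (-(Real.pi / 2) * z ^ 2 - Real.pi * (starRingEnd ℂ) z₀ * z +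
      Real.pi / 2 * ‖z₀‖ ^ 2), ?_, fun z => ?_⟩
  · have h1 : Differentiable ℂ
        ((starRingEnd ℂ) ∘ (fun w => ξ (gaussExp (2 * Real.pi * w))) ∘ (starRingEnd ℂ)) :=
      fun z => by
        have := (hF ((starRingEnd ℂ) z)).conj_conj
        rwa [Complex.conj_conj] at this
    exact (h1.const_mul _).mul (by fun_prop)
  · have e : -Real.pi * z.re ^ 2 + Real.pi / 2 * ‖z - z₀‖ ^ 2 =
        (-(Real.pi / 2) * z ^ 2 - Real.pi * (starRingEnd ℂ) z₀ * z +
          Real.pi / 2 * ‖z₀‖ ^ 2 : ℂ).re := by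
      rw [← Complex.ofReal_pow, Complex.sq_norm, Complex.sq_norm]
      simp [Complex.normSq_apply, pow_two]
      ring
    rw [norm_mul, norm_mul, Complex.norm_exp, ← e, Real.exp_add, gabor_eq]
    simp only [Complex.eta, norm_mul, Complex.norm_real, RCLike.norm_conj, Real.norm_eq_abs,
      Complex.ofReal_mul, Real.abs_exp]
    ring

theorem exp_sq_gabor_le_lintegral (ξ : 𝓢'(ℝ, ℂ)) (z₀ : ℂ) {c : ℝ} (hc : 0 ≤ c) :
    ENNReal.ofReal (Real.pi / 16) *
        ENNReal.ofReal (Real.exp (c * ‖gabor ξ z₀.re z₀.im‖ ^ 2)) ≤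
      ∫⁻ z in Metric.ball z₀ (1 / 4),
        ENNReal.ofReal (Real.exp (3 / 2 * c * ‖gabor ξ z.re z.im‖ ^ 2)) := by
  obtain ⟨H, hH, hHn⟩ := exists_entire_norm_eq_gabor ξ z₀
  -- Linearizing `|H|²` at `z₀` gives an entire exponent: `|A| = exp (c (|H|² - |H - H z₀|²))` is
  -- dominated by `exp (c |H|²)`, with equality at `z₀`.
  set A : ℂ → ℂ := fun z => Complex.exp (c * (2 * (starRingEnd ℂ) (H z₀) * H z - ‖H z₀‖ ^ 2))
  have hA : Differentiable ℂ A := by fun_prop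
  have hAn : ∀ z, ‖A z‖ = Real.exp (c * (‖H z‖ ^ 2 - ‖H z - H z₀‖ ^ 2)) := by
    intro z
    rw [Complex.norm_exp, ← Complex.ofReal_pow]
    congr 1
    simp [Complex.sq_norm, Complex.normSq_apply]
    left
    ring
  have h := enorm_le_lintegral_ball hA z₀ (r := 1 / 4) (by norm_num)
  have hH0 : ‖H z₀‖ = ‖gabor ξ z₀.re z₀.im‖ := by simp [hHn]
  have e0 : ‖A z₀‖ₑ = ENNReal.ofReal (Real.exp (c * ‖gabor ξ z₀.re z₀.im‖ ^ 2)) := by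
    rw [← ofReal_norm, hAn, ← hH0]; simp
  rw [e0, show Real.pi * (1 / 4) ^ 2 = Real.pi / 16 by ring] at h
  refine h.trans (setLIntegral_mono' Metric.isOpen_ball.measurableSet fun z hz => ?_)
  rw [← ofReal_norm, hAn]
  refine ENNReal.ofReal_le_ofReal (Real.exp_le_exp.mpr ?_)
  have h1 : ‖H z‖ ^ 2 ≤ 3 / 2 * ‖gabor ξ z.re z.im‖ ^ 2 := by
    have hz' : ‖z - z₀‖ < 1 / 4 := by simpa [dist_eq_norm] using hz
    -- On the disc of radius 1/4 the squared weight is at most `exp (π/16) ≤ exp (1/4) ≤ 4/3`.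
    have h2 : Real.exp (Real.pi / 2 * ‖z - z₀‖ ^ 2) ^ 2 ≤ 3 / 2 := by
      rw [← Real.exp_nat_mul]
      have h3 : ((2 : ℕ) : ℝ) * (Real.pi / 2 * ‖z - z₀‖ ^ 2) ≤ 1 / 4 := by
        have : ‖z - z₀‖ ^ 2 ≤ (1 / 4) ^ 2 := by gcongr
        push_cast
        nlinarith [Real.pi_lt_four, Real.pi_pos]
      refine (Real.exp_le_exp.mpr h3).trans ?_
      have h4 := Real.exp_bound_div_one_sub_of_interval (x := 1 / 4) (by norm_num) (by norm_num)
      norm_num at h4 ⊢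
      linarith
    rw [hHn, mul_pow, mul_comm]
    gcongr
  nlinarith [sq_nonneg ‖H z - H z₀‖, mul_le_mul_of_nonneg_left h1 hc,
    mul_nonneg hc (sq_nonneg ‖H z - H z₀‖)]

/-! ### Gaussian moments of the Gabor transform of white noise -/

/-- For positive variance the integral is `(1 - 3/4)^(-1/2) = 2`. For `v = 0` the division by zero
makes the integrand 1. -/
theorem lintegral_exp_sq_gaussianReal_le (v : NNReal) :
    ∫⁻ x, ENNReal.ofReal (Real.exp (3 / 8 * (x ^ 2 / v))) ∂ProbabilityTheory.gaussianReal 0 v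
      ≤ 2 := by
  by_cases hv : v = 0
  · subst hv
    simp
  have hv' : (0 : ℝ) < v := by positivity
  have hm : Measurable fun x : ℝ => ENNReal.ofReal (Real.exp (3 / 8 * (x ^ 2 / v))) := by fun_prop
  have e : ∀ x : ℝ, (ProbabilityTheory.gaussianPDF 0 v *
      fun x : ℝ => ENNReal.ofReal (Real.exp (3 / 8 * (x ^ 2 / v)))) x =
      ENNReal.ofReal ((Real.sqrt (2 * Real.pi * v))⁻¹ * Real.exp (-(1 / (8 * v)) * x ^ 2)) := by
    intro x
    rw [Pi.mul_apply, ProbabilityTheory.gaussianPDF_def, ProbabilityTheory.gaussianPDFReal_def,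
      ← ENNReal.ofReal_mul (by positivity), mul_assoc, ← Real.exp_add]
    congr 3
    field_simp
    ring
  rw [ProbabilityTheory.gaussianReal_of_var_ne_zero 0 hv,
    lintegral_withDensity_eq_lintegral_mul _ (ProbabilityTheory.measurable_gaussianPDF 0 v) hm]
  simp only [e]
  rw [← ofReal_integral_eq_lintegral_ofReal, integral_const_mul, integral_gaussian,
    ← Real.sqrt_inv, ← Real.sqrt_mul (by positivity)]
  · have : (2 * Real.pi * v)⁻¹ * (Real.pi / (1 / (8 * v))) = (2 : ℝ) ^ 2 := by
      field_simp
      norm_num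
    rw [this, Real.sqrt_sq (by norm_num)]
    simp
  · exact (integrable_exp_neg_mul_sq (by positivity)).const_mul _
  · exact Filter.Eventually.of_forall fun x => by positivity

/-- Covers the degenerate variance: when `v = 0` the law is the Dirac mass at 0, so both sides
vanish almost surely. -/
theorem ae_sq_eq_gaussianReal (v : NNReal) :
    ∀ᵐ x : ℝ ∂ProbabilityTheory.gaussianReal 0 v, x ^ 2 = (v : ℝ) * (x ^ 2 / v) := by
  by_cases hv : v = 0
  · subst hv
    rw [ProbabilityTheory.gaussianReal_zero_var, ae_dirac_eq]
    simp
  · have hv' : (v : ℝ) ≠ 0 := by simpa using hv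
    exact Filter.Eventually.of_forall fun x => by field_simp

theorem measurable_apply_schwartz (φ : 𝓢(ℝ, ℂ)) : Measurable fun ξ : 𝓢'(ℝ, ℂ) => ξ φ := by
  have h : Continuous fun ξ : 𝓢'(ℝ, ℂ) => ξ φ :=
    (PointwiseConvergenceCLM.evalCLM (RingHom.id ℂ) ℂ φ).continuous
  exact h.measurable

theorem IsWhiteNoise.map_re_eq {μ : Measure 𝓢'(ℝ, ℂ)} [IsProbabilityMeasure μ]
    (hμ : IsWhiteNoise μ) {φ : 𝓢(ℝ, ℂ)} (hφ : ∀ x, (φ x).im = 0) :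
    μ.map (fun ξ => (ξ φ).re) =
      ProbabilityTheory.gaussianReal 0 (Real.toNNReal (∫ x, ‖φ x‖ ^ 2)) := by
  have hm : Measurable fun ξ : 𝓢'(ℝ, ℂ) => (ξ φ).re :=
    Complex.measurable_re.comp (measurable_apply_schwartz φ)
  have : IsProbabilityMeasure (μ.map (fun ξ => (ξ φ).re)) :=
    Measure.isProbabilityMeasure_map hm.aemeasurable
  refine Measure.ext_of_charFun (funext fun t => ?_)
  have ht : ∀ x, (((t : ℂ) • φ) x).im = 0 := by
    intro x
    simp [hφ x]
  have h1 := hμ.charFun _ ht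
  rw [charFun_apply_real, integral_map hm.aemeasurable
    (by exact (Continuous.aestronglyMeasurable (by fun_prop))),
    ProbabilityTheory.charFun_gaussianReal]
  have h2 : ∫ ξ, Complex.exp (Complex.I * ξ ((t : ℂ) • φ)) ∂μ =
      ∫ ξ, Complex.exp (t * ((ξ φ).re : ℂ) * Complex.I) ∂μ := by
    refine integral_congr_ae ?_
    filter_upwards [hμ.isReal φ hφ] with ξ hξ
    have : ξ φ = ((ξ φ).re : ℂ) := Complex.ext rfl (by simpa using hξ)
    rw [map_smul, smul_eq_mul, this]
    congr 1
    simp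
    ring
  have h3 : ∫ x, ‖((t : ℂ) • φ) x‖ ^ 2 = t ^ 2 * ∫ x, ‖φ x‖ ^ 2 := by
    rw [← integral_const_mul]
    congr 1
    funext x
    simp [mul_pow]
  rw [← h2, h1, h3, Real.coe_toNNReal _ (integral_nonneg fun x => by positivity)]
  push_cast
  congr 1
  ring

/-- Convexity of `exp`, with the two variances as weights. Real and imaginary parts can thus be
treated separately, without independence or joint laws. -/
theorem exp_sq_add_sq_le {c x y p q : ℝ} (hp : 0 ≤ p) (hq : 0 ≤ q) (hpq : p + q = 1)
    (hx : x ^ 2 = p * (x ^ 2 / p)) (hy : y ^ 2 = q * (y ^ 2 / q)) :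
    Real.exp (c * (x ^ 2 + y ^ 2)) ≤
      p * Real.exp (c * (x ^ 2 / p)) + q * Real.exp (c * (y ^ 2 / q)) := by
  have h := convexOn_exp.2 (Set.mem_univ (c * (x ^ 2 / p))) (Set.mem_univ (c * (y ^ 2 / q)))
    hp hq hpq
  simp only [smul_eq_mul] at h
  refine le_trans (le_of_eq ?_) h
  congr 1
  nth_rewrite 1 [hx]
  nth_rewrite 1 [hy]
  ring

theorem IsWhiteNoise.lintegral_exp_sq_le {μ : Measure 𝓢'(ℝ, ℂ)} [IsProbabilityMeasure μ]
    (hμ : IsWhiteNoise μ) {φ ψ : 𝓢(ℝ, ℂ)} (hφ : ∀ x, (φ x).im = 0) (hψ : ∀ x, (ψ x).im = 0)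
    (h1 : (∫ x, ‖φ x‖ ^ 2) + ∫ x, ‖ψ x‖ ^ 2 = 1) :
    ∫⁻ ξ, ENNReal.ofReal (Real.exp (3 / 8 * ‖ξ (φ + Complex.I • ψ)‖ ^ 2)) ∂μ ≤ 2 := by
  set p := Real.toNNReal (∫ x, ‖φ x‖ ^ 2) with hp
  set q := Real.toNNReal (∫ x, ‖ψ x‖ ^ 2) with hq
  have hp' : (p : ℝ) = ∫ x, ‖φ x‖ ^ 2 :=
    Real.coe_toNNReal _ (integral_nonneg fun x => by positivity)
  have hq' : (q : ℝ) = ∫ x, ‖ψ x‖ ^ 2 :=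
    Real.coe_toNNReal _ (integral_nonneg fun x => by positivity)
  have hpq : (p : ℝ) + q = 1 := by rw [hp', hq', h1]
  have hm : ∀ χ : 𝓢(ℝ, ℂ), Measurable fun ξ : 𝓢'(ℝ, ℂ) => (ξ χ).re := fun χ =>
    Complex.measurable_re.comp (measurable_apply_schwartz χ)
  have hφl := hμ.map_re_eq hφ
  have hψl := hμ.map_re_eq hψ
  have hE : ∀ (v : NNReal) (χ : 𝓢(ℝ, ℂ)),
      μ.map (fun ξ => (ξ χ).re) = ProbabilityTheory.gaussianReal 0 v →
      ∫⁻ ξ, ENNReal.ofReal (Real.exp (3 / 8 * ((ξ χ).re ^ 2 / v))) ∂μ ≤ 2 := by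
    intro v χ h
    refine le_trans (le_of_eq ?_) (lintegral_exp_sq_gaussianReal_le v)
    rw [← h, lintegral_map (by fun_prop) (hm χ)]
  have hS : ∀ (v : NNReal) (χ : 𝓢(ℝ, ℂ)),
      μ.map (fun ξ => (ξ χ).re) = ProbabilityTheory.gaussianReal 0 v →
      ∀ᵐ ξ ∂μ, (ξ χ).re ^ 2 = (v : ℝ) * ((ξ χ).re ^ 2 / v) := fun v χ h =>
    ae_of_ae_map (hm χ).aemeasurable (by rw [h]; exact ae_sq_eq_gaussianReal v)
  calc _ ≤ ∫⁻ ξ, ((p : ENNReal) * ENNReal.ofReal (Real.exp (3 / 8 * ((ξ φ).re ^ 2 / p))) +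
        (q : ENNReal) * ENNReal.ofReal (Real.exp (3 / 8 * ((ξ ψ).re ^ 2 / q)))) ∂μ := by
        refine lintegral_mono_ae ?_
        filter_upwards [hμ.isReal φ hφ, hμ.isReal ψ hψ, hS p φ hφl, hS q ψ hψl] with ξ i1 i2 s1 s2
        have e : ‖ξ (φ + Complex.I • ψ)‖ ^ 2 = (ξ φ).re ^ 2 + (ξ ψ).re ^ 2 := by
          rw [map_add, map_smul, Complex.sq_norm, Complex.normSq_apply]
          simp [i1, i2]
          ring
        rw [e, ← ENNReal.ofReal_coe_nnreal, ← ENNReal.ofReal_coe_nnreal,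
          ← ENNReal.ofReal_mul p.coe_nonneg, ← ENNReal.ofReal_mul q.coe_nonneg,
          ← ENNReal.ofReal_add (by positivity) (by positivity)]
        exact ENNReal.ofReal_le_ofReal (exp_sq_add_sq_le p.2 q.2 hpq s1 s2)
    _ ≤ (p : ENNReal) * 2 + (q : ENNReal) * 2 := by
        have hme : ∀ (v : NNReal) (χ : 𝓢(ℝ, ℂ)), Measurable fun ξ : 𝓢'(ℝ, ℂ) =>
            ENNReal.ofReal (Real.exp (3 / 8 * ((ξ χ).re ^ 2 / v))) := fun v χ =>
          (Real.measurable_exp.comp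
            ((((hm χ).pow_const 2).div_const _).const_mul _)).ennreal_ofReal
        rw [lintegral_add_left ((hme p φ).const_mul _), lintegral_const_mul _ (hme p φ),
          lintegral_const_mul _ (hme q ψ)]
        gcongr
        · exact hE p φ hφl
        · exact hE q ψ hψl
    _ = 2 := by
        rw [← add_mul, ← ENNReal.coe_add, show p + q = 1 from NNReal.eq hpq]
        simp

theorem conj_conjGaborAtom (u v t : ℝ) :
    (starRingEnd ℂ) (conjGaborAtom u v t) = conjGaborAtom u (-v) t := by
  change (starRingEnd ℂ) ((starRingEnd ℂ) (gaborAtom u v t)) =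
    (starRingEnd ℂ) (gaborAtom u (-v) t)
  simp [gaborAtom, ← Complex.exp_conj, map_ofNat]

theorem norm_sq_conjGaborAtom (u v t : ℝ) :
    ‖conjGaborAtom u v t‖ ^ 2 = Real.sqrt 2 * Real.exp (-(2 * Real.pi) * (t - u) ^ 2) := by
  change ‖(starRingEnd ℂ) (gaborAtom u v t)‖ ^ 2 = _
  have h1 : ‖Complex.exp (2 * Real.pi * Complex.I * v * t)‖ = 1 := by
    rw [Complex.norm_exp]; simp
  have h2 : ((2 : ℝ) ^ (1 / 4 : ℝ)) ^ 2 = Real.sqrt 2 := by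
    rw [← Real.rpow_natCast, ← Real.rpow_mul (by norm_num), Real.sqrt_eq_rpow]
    norm_num
  rw [RCLike.norm_conj, gaborAtom, norm_mul, h1, one_mul, Complex.norm_real, gaussWindow,
    Real.norm_eq_abs, sq_abs, mul_pow, h2, ← Real.exp_nat_mul]
  congr 2
  push_cast
  ring

theorem integral_norm_sq_conjGaborAtom (u v : ℝ) : ∫ t, ‖conjGaborAtom u v t‖ ^ 2 = 1 := by
  simp only [norm_sq_conjGaborAtom]
  rw [integral_const_mul,
    integral_sub_right_eq_self (fun t : ℝ => Real.exp (-(2 * Real.pi) * t ^ 2)) u,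
    integral_gaussian, ← Real.sqrt_mul (by norm_num)]
  have : 2 * (Real.pi / (2 * Real.pi)) = 1 := by field_simp
  rw [this, Real.sqrt_one]

theorem integrable_norm_sq_schwartz (φ : 𝓢(ℝ, ℂ)) : Integrable fun x => ‖φ x‖ ^ 2 := by
  have := (φ.memLp 2).integrable_norm_pow (by norm_num)
  simpa using this

/-- Exponential square integrability of the Gabor transform of white noise. -/
theorem IsWhiteNoise.lintegral_exp_sq_gabor_le {μ : Measure 𝓢'(ℝ, ℂ)} [IsProbabilityMeasure μ]
    (hμ : IsWhiteNoise μ) (u v : ℝ) :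
    ∫⁻ ξ, ENNReal.ofReal (Real.exp (3 / 8 * ‖gabor ξ u v‖ ^ 2)) ∂μ ≤ 2 := by
  -- `φ` and `ψ` are the real and imaginary parts of the atom; conjugation flips the sign of `v`, so
  -- both are visibly Schwartz.
  set φ : 𝓢(ℝ, ℂ) := (1 / 2 : ℂ) • (conjGaborAtom u v + conjGaborAtom u (-v)) with hφ
  set ψ : 𝓢(ℝ, ℂ) := (-Complex.I / 2 : ℂ) • (conjGaborAtom u v - conjGaborAtom u (-v)) with hψ
  have e : conjGaborAtom u v = φ + Complex.I • ψ := by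
    rw [hφ, hψ, smul_smul]
    have : Complex.I * (-Complex.I / 2) = 1 / 2 := by
      rw [mul_div_assoc', mul_neg, Complex.I_mul_I, neg_neg]
    rw [this]
    module
  have h1 : ∀ x, φ x = ((conjGaborAtom u v x).re : ℂ) := by
    intro x
    rw [Complex.re_eq_add_conj, conj_conjGaborAtom]
    simp [hφ]
    ring
  have h2 : ∀ x, ψ x = ((conjGaborAtom u v x).im : ℂ) := by
    intro x
    rw [Complex.im_eq_sub_conj, conj_conjGaborAtom]
    simp [hψ]
    field_simp
    simp
  have := hμ.lintegral_exp_sq_le (φ := φ) (ψ := ψ) (fun x => by rw [h1]; simp)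
    (fun x => by rw [h2]; simp) (by
      rw [← integral_add (integrable_norm_sq_schwartz φ) (integrable_norm_sq_schwartz ψ),
        ← integral_norm_sq_conjGaborAtom u v]
      congr 1
      funext x
      rw [h1, h2, Complex.norm_real, Complex.norm_real, Complex.sq_norm, Complex.normSq_apply]
      simp [pow_two])
  rwa [← e] at this

/-! ### The supremum of the Gabor transform of white noise over a square -/

theorem box_eq_preimage (L : ℝ) : box L =
    Complex.measurableEquivRealProd ⁻¹' (Set.Icc (-L) L ×ˢ Set.Icc (-L) L) := by
  ext z
  simp only [box, Set.mem_ofPred_eq, max_le_iff, abs_le, Set.mem_preimage, Set.mem_prod,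
    Set.mem_Icc, Complex.measurableEquivRealProd_apply]

theorem volume_box (L : ℝ) (hL : 0 ≤ L) : volume (box L) = ENNReal.ofReal ((2 * L) ^ 2) := by
  rw [box_eq_preimage, Complex.volume_preserving_equiv_real_prod.measure_preimage
    (measurableSet_Icc.prod measurableSet_Icc).nullMeasurableSet, Measure.volume_eq_prod,
    Measure.prod_prod, Real.volume_Icc, ← ENNReal.ofReal_mul (by linarith)]
  congr 1
  ring

theorem ball_subset_box {L : ℝ} {z : ℂ} (hz : z ∈ box L) :
    Metric.ball z (1 / 4) ⊆ box (L + 1) := by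
  intro w hw
  have h : ‖w - z‖ < 1 / 4 := by simpa [dist_eq_norm] using hw
  have h1 := (Complex.abs_re_le_norm (w - z)).trans h.le
  have h2 := (Complex.abs_im_le_norm (w - z)).trans h.le
  rw [Complex.sub_re, abs_le] at h1
  rw [Complex.sub_im, abs_le] at h2
  obtain ⟨h3, h4⟩ := max_le_iff.mp (show max |z.re| |z.im| ≤ L from hz)
  rw [abs_le] at h3 h4
  change max |w.re| |w.im| ≤ L + 1
  exact max_le (abs_le.mpr ⟨by linarith [h1.1, h3.1], by linarith [h1.2, h3.2]⟩)
    (abs_le.mpr ⟨by linarith [h2.1, h4.1], by linarith [h2.2, h4.2]⟩)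

theorem measurable_gabor (z : ℂ) : Measurable fun ξ : 𝓢'(ℝ, ℂ) => gabor ξ z.re z.im :=
  measurable_apply_schwartz _

/-- A Carathéodory function: continuous in `z` and measurable in `ξ`, hence jointly measurable. -/
theorem measurable_uncurry_exp_sq_gabor : Measurable (Function.uncurry fun (ξ : 𝓢'(ℝ, ℂ))
    (z : ℂ) => ENNReal.ofReal (Real.exp (3 / 8 * ‖gabor ξ z.re z.im‖ ^ 2))) := by
  have h : Measurable (Function.uncurry fun (z : ℂ) (ξ : 𝓢'(ℝ, ℂ)) => gabor ξ z.re z.im) :=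
    measurable_uncurry_of_continuous_of_measurable continuous_gabor measurable_gabor
  have he : Measurable fun w : ℂ => ENNReal.ofReal (Real.exp (3 / 8 * ‖w‖ ^ 2)) := by fun_prop
  exact he.comp (h.comp measurable_swap)

theorem gabor_smul (c : ℂ) (ξ : 𝓢'(ℝ, ℂ)) (u v : ℝ) : gabor (c • ξ) u v = c * gabor ξ u v := rfl

theorem IsWhiteNoise.lintegral_box_le {μ : Measure 𝓢'(ℝ, ℂ)} [IsProbabilityMeasure μ]
    (hμ : IsWhiteNoise μ) {L : ℝ} (hL : 0 ≤ L) :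
    ∫⁻ ξ, (∫⁻ z : ℂ in box L,
      ENNReal.ofReal (Real.exp (3 / 8 * ‖gabor ξ z.re z.im‖ ^ 2))) ∂μ ≤
      2 * ENNReal.ofReal ((2 * L) ^ 2) := by
  rw [lintegral_lintegral_swap
    measurable_uncurry_exp_sq_gabor.aemeasurable]
  calc _ ≤ ∫⁻ _ : ℂ in box L, 2 := lintegral_mono fun z => hμ.lintegral_exp_sq_gabor_le z.re z.im
    _ = _ := by rw [setLIntegral_const, volume_box L hL]

theorem IsWhiteNoise.measure_exists_lt_gabor_le {μ : Measure 𝓢'(ℝ, ℂ)} [IsProbabilityMeasure μ]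
    (hμ : IsWhiteNoise μ) {σ L S : ℝ} (hσ : 0 ≤ σ) (hσ' : σ ≤ Real.sqrt Real.pi)
    (hL : 0 ≤ L) (hS : 0 ≤ S) :
    μ {ξ | ∃ z ∈ box L, S < ‖gabor ((σ : ℂ) • ξ) z.re z.im‖} ≤
      ENNReal.ofReal (128 / Real.pi * (L + 1) ^ 2 * Real.exp (-(S ^ 2 / (4 * Real.pi)))) := by
  set T : ENNReal := ENNReal.ofReal (Real.pi / 16 * Real.exp (S ^ 2 / (4 * Real.pi))) with hT
  have hσ2 : σ ^ 2 ≤ Real.pi := by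
    rw [← Real.sq_sqrt Real.pi_pos.le]
    gcongr
  have hsub : {ξ : 𝓢'(ℝ, ℂ) | ∃ z ∈ box L, S < ‖gabor ((σ : ℂ) • ξ) z.re z.im‖} ⊆
      {ξ | T ≤ ∫⁻ z in box (L + 1),
        ENNReal.ofReal (Real.exp (3 / 8 * ‖gabor ξ z.re z.im‖ ^ 2))} := by
    rintro ξ ⟨z, hz, hzS⟩
    rw [gabor_smul, norm_mul, Complex.norm_real, Real.norm_of_nonneg hσ] at hzS
    -- Since `σ² ≤ π`, this `c` is at most 1/4, so the exponent `3/2 * c` on the right stays below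
    -- the integrable 3/8.
    have h := exp_sq_gabor_le_lintegral ξ z (c := σ ^ 2 / (4 * Real.pi)) (by positivity)
    rw [← ENNReal.ofReal_mul (by positivity)] at h
    refine le_trans (ENNReal.ofReal_le_ofReal ?_) (h.trans ?_)
    · have : S ^ 2 ≤ (σ * ‖gabor ξ z.re z.im‖) ^ 2 := by gcongr
      have e : σ ^ 2 / (4 * Real.pi) * ‖gabor ξ z.re z.im‖ ^ 2 =
          (σ * ‖gabor ξ z.re z.im‖) ^ 2 / (4 * Real.pi) := by ring
      rw [e]
      gcongr
    · refine (lintegral_mono_set (ball_subset_box hz)).trans (lintegral_mono fun w => ?_)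
      refine ENNReal.ofReal_le_ofReal (Real.exp_le_exp.mpr ?_)
      refine mul_le_mul_of_nonneg_right ?_ (sq_nonneg _)
      have : σ ^ 2 / (4 * Real.pi) ≤ 1 / 4 := by
        rw [div_le_div_iff₀ (by positivity) (by norm_num)]
        linarith
      linarith
  have hTpos : 0 < Real.pi / 16 * Real.exp (S ^ 2 / (4 * Real.pi)) := by positivity
  have hM : Measurable fun ξ : 𝓢'(ℝ, ℂ) => ∫⁻ z in box (L + 1),
      ENNReal.ofReal (Real.exp (3 / 8 * ‖gabor ξ z.re z.im‖ ^ 2)) :=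
    measurable_uncurry_exp_sq_gabor.lintegral_prod_right
  refine (measure_mono hsub).trans ((meas_ge_le_lintegral_div hM.aemeasurable
    (ENNReal.ofReal_pos.mpr hTpos).ne' ENNReal.ofReal_ne_top).trans ?_)
  refine (ENNReal.div_le_div_right (hμ.lintegral_box_le (by linarith)) _).trans (le_of_eq ?_)
  rw [show (2 : ENNReal) = ENNReal.ofReal 2 by simp, ← ENNReal.ofReal_mul (by norm_num),
    ← ENNReal.ofReal_div_of_pos hTpos, Real.exp_neg]
  congr 1
  field_simp
  ring

theorem exp_tail_le {L τ : ℝ} (hL : Real.pi ≤ L) (hτ : 0 < τ) :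
    128 / Real.pi * (L + 1) ^ 2 *
      Real.exp (-((Real.sqrt 2 * (14 + τ) * Real.sqrt (Real.log L)) ^ 2 / (4 * Real.pi))) ≤
    4 * Real.exp (-(τ ^ 2 / (2 * Real.pi) * Real.log L)) := by
  have hπ3 := Real.pi_gt_three
  have hL0 : 0 < L := by linarith
  have hlog : 0 ≤ Real.log L := Real.log_nonneg (by linarith)
  have e : (Real.sqrt 2 * (14 + τ) * Real.sqrt (Real.log L)) ^ 2 / (4 * Real.pi) =
      (14 + τ) ^ 2 / (2 * Real.pi) * Real.log L := by
    rw [mul_pow, mul_pow, Real.sq_sqrt (by norm_num), Real.sq_sqrt hlog]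
    field_simp
    ring
  -- The margin is `196 - 20π > 0`; the resulting factor `L ^ (-10)` beats `128/π * (L + 1)²`.
  have h1 : 10 * Real.log L + τ ^ 2 / (2 * Real.pi) * Real.log L ≤
      (14 + τ) ^ 2 / (2 * Real.pi) * Real.log L := by
    rw [← add_mul]
    refine mul_le_mul_of_nonneg_right ?_ hlog
    rw [← sub_nonneg]
    have : (14 + τ) ^ 2 / (2 * Real.pi) - (10 + τ ^ 2 / (2 * Real.pi)) =
        (196 + 28 * τ - 20 * Real.pi) / (2 * Real.pi) := by
      field_simp
      ring
    rw [this]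
    refine div_nonneg ?_ (by positivity)
    linarith [Real.pi_lt_four]
  have h2 : Real.exp (-(10 * Real.log L)) = (L ^ 10)⁻¹ := by
    rw [Real.exp_neg]
    congr 1
    rw [mul_comm, Real.exp_mul, Real.exp_log hL0]
    exact_mod_cast Real.rpow_natCast L 10
  have h3 : 128 / Real.pi * (L + 1) ^ 2 * (L ^ 10)⁻¹ ≤ 4 := by
    rw [← div_eq_mul_inv, div_le_iff₀ (by positivity)]
    have h4 : 128 / Real.pi ≤ 128 / 3 := by gcongr
    have h5 : (L + 1) ^ 2 ≤ (2 * L) ^ 2 := by gcongr; linarith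
    have h6 : (3 : ℝ) ^ 8 ≤ L ^ 8 := by gcongr; linarith
    calc _ ≤ 128 / 3 * (2 * L) ^ 2 := by gcongr
      _ ≤ 4 * (3 ^ 8 * L ^ 2) := by nlinarith [sq_nonneg L]
      _ ≤ 4 * (L ^ 8 * L ^ 2) := by gcongr
      _ = _ := by ring
  rw [e]
  calc _ ≤ 128 / Real.pi * (L + 1) ^ 2 *
        Real.exp (-(10 * Real.log L) + -(τ ^ 2 / (2 * Real.pi) * Real.log L)) := by
        gcongr
        linarith
    _ = 128 / Real.pi * (L + 1) ^ 2 * (L ^ 10)⁻¹ *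
        Real.exp (-(τ ^ 2 / (2 * Real.pi) * Real.log L)) := by
        rw [Real.exp_add, h2, mul_assoc, mul_assoc, mul_assoc]
    _ ≤ _ := by gcongr

/-- With high probability the Gabor transform of white noise is small on a large square. -/
theorem IsWhiteNoise.le_measureReal_forall_gabor_le {μ : Measure 𝓢'(ℝ, ℂ)}
    [IsProbabilityMeasure μ] (hμ : IsWhiteNoise μ) {σ L τ : ℝ} (hσ : 0 ≤ σ)
    (hσ' : σ ≤ Real.sqrt Real.pi) (hL : Real.pi ≤ L) (hτ : 0 < τ) :
    1 - 4 * Real.exp (-(τ ^ 2 / (2 * Real.pi) * Real.log L)) ≤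
      μ.real {ξ | ∀ z ∈ box L, ‖gabor ((σ : ℂ) • ξ) z.re z.im‖ ≤
        Real.sqrt 2 * (14 + τ) * Real.sqrt (Real.log L)} := by
  set S := Real.sqrt 2 * (14 + τ) * Real.sqrt (Real.log L) with hS
  set E := {ξ : 𝓢'(ℝ, ℂ) | ∀ z ∈ box L, ‖gabor ((σ : ℂ) • ξ) z.re z.im‖ ≤ S}
  have hc : Eᶜ = {ξ | ∃ z ∈ box L, S < ‖gabor ((σ : ℂ) • ξ) z.re z.im‖} := by
    ext ξ
    simp [E]
  have h1 : μ.real Eᶜ ≤ 4 * Real.exp (-(τ ^ 2 / (2 * Real.pi) * Real.log L)) := by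
    rw [hc]
    exact ENNReal.toReal_le_of_le_ofReal (by positivity)
      ((hμ.measure_exists_lt_gabor_le hσ hσ' (Real.pi_pos.le.trans hL) (by positivity)).trans
        (ENNReal.ofReal_le_ofReal (exp_tail_le hL hτ)))
  -- Subadditivity suffices here, so `E` need not be shown measurable.
  have h2 : 1 ≤ μ.real E + μ.real Eᶜ := by
    have := measureReal_union_le (μ := μ) E Eᶜ
    rwa [Set.union_compl_self, probReal_univ] at this
  linarith

/-! ### The Gabor transform of the Hermite functions -/

theorem integrable_iteratedDeriv_gauss_mul_cexp (k : ℕ) (c : ℂ) :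
    Integrable fun t : ℝ =>
      ((iteratedDeriv k (fun t : ℝ => Real.exp (-2 * Real.pi * t ^ 2)) t : ℝ) : ℂ) *
      Complex.exp (c * t) := by
  obtain ⟨P, hP⟩ := iteratedDeriv_gauss k
  set Q : Polynomial ℂ := P.map Complex.ofRealHom
  let φ : 𝓢(ℝ, ℂ) := ⟨polyGauss Q c, polyGauss_contDiff _ _ _, polyGauss_schwartz_decay _ _⟩
  -- Half of the Gaussian goes into the Schwartz function `φ`; the other half is a bounded factor.
  have h1 : Integrable fun t : ℝ => φ t * ((Real.exp (-Real.pi * t ^ 2) : ℝ) : ℂ) := by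
    refine φ.integrable.mul_bdd (c := 1)
      (Continuous.aestronglyMeasurable (by fun_prop)) (Filter.Eventually.of_forall fun t => ?_)
    rw [Complex.norm_real, Real.norm_eq_abs, Real.abs_exp, Real.exp_le_one_iff]
    nlinarith [Real.pi_pos, sq_nonneg t, mul_nonneg Real.pi_pos.le (sq_nonneg t)]
  refine h1.congr (Filter.Eventually.of_forall fun t => ?_)
  have e2 : Q.eval (t : ℂ) = ((P.eval t : ℝ) : ℂ) :=
    Polynomial.eval_map_apply (f := Complex.ofRealHom) t
  have e3 : φ t = Q.eval (t : ℂ) * Complex.exp (-(Real.pi : ℂ) * (t : ℂ) ^ 2 + c * t) := rfl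
  beta_reduce
  rw [e3, e2, congrFun hP t, Complex.ofReal_mul, Complex.ofReal_exp, Complex.ofReal_exp, mul_assoc,
    mul_assoc, ← Complex.exp_add, ← Complex.exp_add]
  congr 2
  push_cast
  ring

/-- Each integration by parts moves one derivative onto the exponential and contributes a factor
`-c`. -/
theorem integral_iteratedDeriv_gauss_mul_cexp (k : ℕ) (c : ℂ) :
    ∫ t : ℝ, ((iteratedDeriv k (fun t : ℝ => Real.exp (-2 * Real.pi * t ^ 2)) t : ℝ) : ℂ) *
      Complex.exp (c * t) =
    (-c) ^ k * ((1 / 2 : ℂ) ^ (1 / 2 : ℂ) * Complex.exp (c ^ 2 / (8 * Real.pi))) := by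
  induction k with
  | zero =>
    have h := integral_cexp_quadratic (b := ((-2 * Real.pi : ℝ) : ℂ))
      (by rw [Complex.ofReal_re]; linarith [Real.pi_pos]) c 0
    rw [pow_zero, one_mul]
    have hπ : (Real.pi : ℂ) ≠ 0 := by exact_mod_cast Real.pi_ne_zero
    have e1 : (Real.pi : ℂ) / -((-2 * Real.pi : ℝ) : ℂ) = 1 / 2 := by
      push_cast
      field_simp
    have e2 : 0 - c ^ 2 / (4 * ((-2 * Real.pi : ℝ) : ℂ)) = c ^ 2 / (8 * Real.pi) := by
      push_cast
      field_simp
      ring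
    rw [e1, e2] at h
    rw [← h]
    refine integral_congr_ae (Filter.Eventually.of_forall fun t => ?_)
    simp only [iteratedDeriv_zero, Complex.ofReal_exp, ← Complex.exp_add]
    congr 1
    push_cast
    ring
  | succ k ih =>
    set γ : ℝ → ℝ := fun t : ℝ => Real.exp (-2 * Real.pi * t ^ 2) with hγ
    have hγd : ContDiff ℝ ⊤ γ := by fun_prop
    have hd : ∀ t : ℝ, HasDerivAt
        (fun t : ℝ => ((iteratedDeriv k γ t : ℝ) : ℂ) * Complex.exp (c * t))
        (((iteratedDeriv (k + 1) γ t : ℝ) : ℂ) * Complex.exp (c * t) +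
          c * (((iteratedDeriv k γ t : ℝ) : ℂ) * Complex.exp (c * t))) t := by
      intro t
      have h1 : HasDerivAt (iteratedDeriv k γ) (iteratedDeriv (k + 1) γ t) t := by
        rw [iteratedDeriv_succ]
        exact (hγd.differentiable_iteratedDeriv k
          (by exact_mod_cast WithTop.coe_lt_top _) t).hasDerivAt
      have h2 : HasDerivAt (fun t : ℝ => Complex.exp (c * t)) (Complex.exp (c * t) * c) t := by
        have := ((hasDerivAt_id (t : ℂ)).const_mul c).cexp.comp_ofReal
        simpa using this
      convert! h1.ofReal_comp.mul h2 using 1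
      ring
    have hi := integrable_iteratedDeriv_gauss_mul_cexp k c
    have hi' := integrable_iteratedDeriv_gauss_mul_cexp (k + 1) c
    have h0 := integral_eq_zero_of_hasDerivAt_of_integrable hd (hi'.add (hi.const_mul c)) hi
    rw [integral_add hi' (hi.const_mul c), integral_const_mul, ih] at h0
    rw [eq_neg_of_add_eq_zero_left h0, pow_succ]
    ring

theorem norm_gabor_hermiteS (k : ℕ) (z : ℂ) :
    ‖gabor (hermiteS k : 𝓢'(ℝ, ℂ)) z.re z.im‖ =
      Real.sqrt (Real.pi ^ k / k.factorial) * (‖z‖ ^ k * Real.exp (-(Real.pi / 2) * ‖z‖ ^ 2)) := by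
  set a : ℝ := (2 : ℝ) ^ (1 / 4 : ℝ) * Real.exp (-Real.pi * z.re ^ 2) with ha
  set d : ℝ := (-1) ^ k * (2 : ℝ) ^ (1 / 4 : ℝ) / (2 ^ k * Real.sqrt (Real.pi ^ k * k.factorial))
    with hd
  set b : ℂ := 2 * Real.pi * (starRingEnd ℂ) z with hb
  -- The factor `exp (πt²)` in `h_k` cancels the Gaussian of the window, leaving a Laplace transform
  -- of the iterated derivative.
  have h1 : gabor (hermiteS k : 𝓢'(ℝ, ℂ)) z.re z.im = (d * a : ℂ) *
      ((-b) ^ k * ((1 / 2 : ℂ) ^ (1 / 2 : ℂ) * Complex.exp (b ^ 2 / (8 * Real.pi)))) := by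
    rw [gabor_coe, ← integral_iteratedDeriv_gauss_mul_cexp, ← integral_const_mul]
    refine integral_congr_ae (Filter.Eventually.of_forall fun t => ?_)
    have e1 : (starRingEnd ℂ) (gaborAtom z.re z.im t) = a * polyGauss 1 b t := by
      change conjGaborAtom z.re z.im t = _
      rw [conjGaborAtom_eq_smul, smul_apply, gaussExp_apply, Complex.eta, smul_eq_mul]
    have e2 : hermiteS k t = ((d * Real.exp (Real.pi * t ^ 2) *
      iteratedDeriv k (fun t : ℝ => Real.exp (-2 * Real.pi * t ^ 2)) t : ℝ) : ℂ) := rfl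
    have e3 : Complex.exp (b * t) = ((Real.exp (Real.pi * t ^ 2) : ℝ) : ℂ) * polyGauss 1 b t := by
      rw [polyGauss, Polynomial.eval_one, one_mul, Complex.ofReal_exp, ← Complex.exp_add]
      congr 1
      push_cast
      ring
    simp only [e1, e2, e3]
    push_cast
    ring
  have hbn : ‖b‖ = 2 * Real.pi * ‖z‖ := by
    rw [hb, norm_mul, norm_mul, RCLike.norm_conj, Complex.norm_real,
      Real.norm_of_nonneg Real.pi_pos.le]
    simp
  have hbre : (b ^ 2 / (8 * Real.pi)).re = Real.pi / 2 * (z.re ^ 2 - z.im ^ 2) := by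
    have : b ^ 2 / (8 * Real.pi) = ((Real.pi / 2 : ℝ) : ℂ) * (starRingEnd ℂ) z ^ 2 := by
      have hπ : (Real.pi : ℂ) ≠ 0 := by exact_mod_cast Real.pi_ne_zero
      rw [hb]
      push_cast
      field_simp
      ring
    rw [this, Complex.re_ofReal_mul]
    simp [pow_two]
  have hz2 : ‖z‖ ^ 2 = z.re ^ 2 + z.im ^ 2 := by
    rw [Complex.sq_norm, Complex.normSq_apply]; ring
  have hhalf : ‖(1 / 2 : ℂ) ^ (1 / 2 : ℂ)‖ = (Real.sqrt 2)⁻¹ := by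
    have : (1 / 2 : ℂ) ^ (1 / 2 : ℂ) = (((1 / 2 : ℝ) ^ (1 / 2 : ℝ) : ℝ) : ℂ) := by
      rw [Complex.ofReal_cpow (by norm_num)]
      norm_num
    rw [this, Complex.norm_real, ← Real.sqrt_eq_rpow, Real.norm_of_nonneg (Real.sqrt_nonneg _),
      one_div, Real.sqrt_inv]
  have h4 : ((2 : ℝ) ^ (1 / 4 : ℝ)) ^ 2 = Real.sqrt 2 := by
    rw [← Real.rpow_natCast, ← Real.rpow_mul (by norm_num), Real.sqrt_eq_rpow]
    norm_num
  have hexp : Real.exp (-(Real.pi / 2) * ‖z‖ ^ 2) =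
      Real.exp (-Real.pi * z.re ^ 2) * Real.exp (Real.pi / 2 * (z.re ^ 2 - z.im ^ 2)) := by
    rw [← Real.exp_add, hz2]
    congr 1
    ring
  have hdn : |d| = (2 : ℝ) ^ (1 / 4 : ℝ) / (2 ^ k * Real.sqrt (Real.pi ^ k * k.factorial)) := by
    rw [hd, abs_div, abs_mul, abs_pow, abs_neg, abs_one, one_pow, one_mul,
      abs_of_pos (by positivity), abs_of_pos (by positivity)]
  have hsq : Real.sqrt (Real.pi ^ k / k.factorial) =
      Real.pi ^ k / Real.sqrt (Real.pi ^ k * k.factorial) := by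
    rw [eq_div_iff (by positivity), ← Real.sqrt_mul (by positivity)]
    have : Real.pi ^ k / k.factorial * (Real.pi ^ k * k.factorial) = (Real.pi ^ k) ^ 2 := by
      field_simp
    rw [this, Real.sqrt_sq (by positivity)]
  rw [h1, norm_mul, norm_mul, norm_mul, norm_mul, norm_pow, norm_neg, hbn, hhalf, Complex.norm_exp,
    hbre, hexp, Complex.norm_real, Complex.norm_real, Real.norm_eq_abs, Real.norm_eq_abs, hdn,
    abs_of_pos (show 0 < a by positivity), ha, hsq, ← h4,
    mul_pow (2 * Real.pi), mul_pow]
  field_simp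

/-! ### Decay of the Gabor transform of a Hermite function away from its ridge -/

theorem decayRatio_eq (k : ℕ) (r : ℝ) :
    decayRatio k r = ((1 + r) * Real.exp (-(r + r ^ 2 / 2))) ^ k := by
  rw [decayRatio, mul_pow, ← Real.exp_nat_mul, div_eq_mul_inv, ← Real.exp_neg]
  congr 2
  ring

/-- Uses `log x ≤ x - 1` at `x = (1 + r) / (1 + s)`, together with `r + r²/2 = ((1 + r)² - 1) / 2`.
Monotonicity on each side of 0 becomes a polynomial inequality. -/
theorem decayRatio_le_decayRatio (k : ℕ) {r s : ℝ} (hr : 0 ≤ 1 + r) (hs : 0 < 1 + s)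
    (h : (1 + r) / (1 + s) - 1 ≤ ((1 + r) ^ 2 - (1 + s) ^ 2) / 2) :
    decayRatio k r ≤ decayRatio k s := by
  rw [decayRatio_eq, decayRatio_eq]
  refine pow_le_pow_left₀ (by positivity) ?_ k
  have h1 : (1 + r) / (1 + s) ≤ Real.exp ((1 + r) / (1 + s) - 1) := by
    have := Real.add_one_le_exp ((1 + r) / (1 + s) - 1)
    linarith
  rw [div_le_iff₀ hs] at h1
  calc (1 + r) * Real.exp (-(r + r ^ 2 / 2))
      ≤ (Real.exp ((1 + r) / (1 + s) - 1) * (1 + s)) * Real.exp (-(r + r ^ 2 / 2)) := by gcongr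
    _ = (1 + s) * Real.exp ((1 + r) / (1 + s) - 1 + -(r + r ^ 2 / 2)) := by
        rw [Real.exp_add]; ring
    _ ≤ _ := by
        gcongr
        linarith

theorem decayRatio_anti (k : ℕ) {r s : ℝ} (hs : 0 ≤ s) (hsr : s ≤ r) :
    decayRatio k r ≤ decayRatio k s := by
  refine decayRatio_le_decayRatio k (by linarith) (by linarith) ?_
  rw [div_sub_one (by linarith), div_le_iff₀ (by linarith)]
  nlinarith [mul_nonneg (sub_nonneg.mpr hsr) hs, mul_nonneg (mul_nonneg (sub_nonneg.mpr hsr) hs) hs,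
    mul_nonneg (mul_nonneg (sub_nonneg.mpr hsr) hs) (hs.trans hsr),
    mul_nonneg (sub_nonneg.mpr hsr) (hs.trans hsr)]

theorem decayRatio_mono (k : ℕ) {r s : ℝ} (hr : 0 ≤ 1 + r) (hs : 0 < 1 + s) (hrs : r ≤ s)
    (hs0 : s ≤ 0) : decayRatio k r ≤ decayRatio k s := by
  refine decayRatio_le_decayRatio k hr hs ?_
  rw [div_sub_one (by linarith), div_le_iff₀ (by linarith)]
  have h1 : (1 + r + (1 + s)) * (1 + s) ≤ 2 := by nlinarith
  nlinarith [mul_nonneg (sub_nonneg.mpr hrs) (sub_nonneg.mpr h1)]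

theorem decayRatio_zero (k : ℕ) : decayRatio k 0 = 1 := by simp [decayRatio]

theorem decayRatio_le_one (k : ℕ) {r : ℝ} (hr : 0 ≤ 1 + r) : decayRatio k r ≤ 1 := by
  rw [← decayRatio_zero k]
  rcases le_total 0 r with h | h
  · exact decayRatio_anti k le_rfl h
  · exact decayRatio_mono k hr (by norm_num) h le_rfl

theorem decayRatio_lt_one {k : ℕ} (hk : 1 ≤ k) {r : ℝ} (hr : 0 ≤ 1 + r) (hr0 : r ≠ 0) :
    decayRatio k r < 1 := by
  rw [decayRatio_eq]
  refine pow_lt_one₀ (by positivity) ?_ (by omega)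
  calc (1 + r) * Real.exp (-(r + r ^ 2 / 2))
      ≤ Real.exp r * Real.exp (-(r + r ^ 2 / 2)) := by
        gcongr
        linarith [Real.add_one_le_exp r]
    _ = Real.exp (-(r ^ 2 / 2)) := by rw [← Real.exp_add]; congr 1; ring
    _ < 1 := by
        rw [Real.exp_lt_one_iff, neg_lt_zero]
        positivity

theorem betaConst_lt_one {k : ℕ} (hk : 1 ≤ k) : betaConst k < 1 := by
  have h0 : (0 : ℝ) < 1 / (4 * k + 2) := by positivity
  have h1 : (1 : ℝ) / (4 * k + 2) ≤ 1 := by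
    rw [div_le_one (by positivity)]
    linarith [(Nat.cast_nonneg k : (0 : ℝ) ≤ k)]
  exact max_lt (decayRatio_lt_one hk (by linarith) h0.ne')
    (decayRatio_lt_one hk (by linarith) (neg_ne_zero.mpr h0.ne'))

/-- With `δ = 1 / (4k + 2)`, both `k (1 + δ)² ≤ k + 1/2` and `k (1 - δ)² ≥ k - 1/2` hold, so the
assumption forces `|x - 1| ≥ δ`; monotonicity on either side of 1 finishes. -/
theorem decayRatio_le_betaConst {k : ℕ} (hk : 1 ≤ k) {x : ℝ} (hx : 0 ≤ x)
    (h : 1 / 2 ≤ |k * x ^ 2 - k|) : decayRatio k (x - 1) ≤ betaConst k := by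
  have hk' : (1 : ℝ) ≤ k := by exact_mod_cast hk
  have h0 : (0 : ℝ) < 1 / (4 * k + 2) := by positivity
  have h1 : (1 : ℝ) / (4 * k + 2) < 1 := by
    rw [div_lt_one (by positivity)]
    linarith
  set δ : ℝ := 1 / (4 * k + 2) with hδ
  have hkδ : k * δ = 1 / 4 - δ / 2 := by
    rw [hδ]
    field_simp
    ring
  have hδ2 : k * δ ^ 2 = δ / 4 - δ ^ 2 / 2 := by
    have : k * δ ^ 2 = (k * δ) * δ := by ring
    rw [this, hkδ]; ring
  rcases le_abs.mp h with h | h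
  · refine (decayRatio_anti k h0.le ?_).trans (le_max_left _ _)
    have h2 : (1 + δ) ^ 2 ≤ x ^ 2 := by
      refine le_of_mul_le_mul_left ?_ (by linarith : (0 : ℝ) < k)
      nlinarith
    have := abs_le_of_sq_le_sq' h2 hx
    linarith [this.2]
  · refine (decayRatio_mono k (by linarith) (by linarith) ?_ (by linarith)).trans (le_max_right _ _)
    have h2 : x ^ 2 ≤ (1 - δ) ^ 2 := by
      refine le_of_mul_le_mul_left ?_ (by linarith : (0 : ℝ) < k)
      nlinarith
    have := abs_le_of_sq_le_sq' h2 (by linarith)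
    linarith [this.2]

/-- The maximum of the modulus of the Gabor transform of `h_k`. -/
def hermitePeak (k : ℕ) : ℝ :=
  Real.sqrt (Real.pi ^ k / k.factorial) *
    (Real.sqrt (k / Real.pi) ^ k * Real.exp (-(Real.pi / 2) * Real.sqrt (k / Real.pi) ^ 2))

theorem hermitePeak_pos {k : ℕ} (hk : 1 ≤ k) : 0 < hermitePeak k := by
  have : (0 : ℝ) < k := by exact_mod_cast hk
  unfold hermitePeak
  positivity

theorem norm_gabor_hermiteS_eq_peak_mul {k : ℕ} (hk : 1 ≤ k) (z : ℂ) :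
    ‖gabor (hermiteS k : 𝓢'(ℝ, ℂ)) z.re z.im‖ =
      hermitePeak k * decayRatio k (‖z‖ / Real.sqrt (k / Real.pi) - 1) := by
  have hk' : (0 : ℝ) < k := by exact_mod_cast hk
  set ρ := Real.sqrt (k / Real.pi) with hρ
  have hρ0 : 0 < ρ := by positivity
  have hρ2 : ρ ^ 2 = k / Real.pi := Real.sq_sqrt (by positivity)
  obtain ⟨x, hx⟩ : ∃ x, x = ‖z‖ / ρ := ⟨_, rfl⟩
  have hz : ‖z‖ = ρ * x := by rw [hx]; field_simp
  rw [norm_gabor_hermiteS, hermitePeak, ← hρ, ← hx, hz, decayRatio_eq, mul_pow, mul_pow, mul_pow,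
    hρ2, ← Real.exp_nat_mul]
  have : Real.exp (-(Real.pi / 2) * (k / Real.pi * x ^ 2)) =
      Real.exp (-(Real.pi / 2) * (k / Real.pi)) *
        Real.exp (k * -(x - 1 + (x - 1) ^ 2 / 2)) := by
    rw [← Real.exp_add]
    congr 1
    field_simp
    ring
  rw [this, add_sub_cancel]
  ring

theorem norm_gabor_hermiteS_le_peak {k : ℕ} (hk : 1 ≤ k) (z : ℂ) :
    ‖gabor (hermiteS k : 𝓢'(ℝ, ℂ)) z.re z.im‖ ≤ hermitePeak k := by
  rw [norm_gabor_hermiteS_eq_peak_mul hk]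
  refine mul_le_of_le_one_right (hermitePeak_pos hk).le (decayRatio_le_one k ?_)
  rw [add_sub_cancel]
  positivity

theorem norm_gabor_hermiteS_le_of_far {k : ℕ} (hk : 1 ≤ k) {z : ℂ}
    (h : 1 / 2 ≤ |Real.pi * ‖z‖ ^ 2 - k|) :
    ‖gabor (hermiteS k : 𝓢'(ℝ, ℂ)) z.re z.im‖ ≤ hermitePeak k * betaConst k := by
  have hk' : (0 : ℝ) < k := by exact_mod_cast hk
  rw [norm_gabor_hermiteS_eq_peak_mul hk]
  refine mul_le_mul_of_nonneg_left (decayRatio_le_betaConst hk (by positivity) ?_)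
    (hermitePeak_pos hk).le
  rw [div_pow, Real.sq_sqrt (by positivity)]
  have : k * (‖z‖ ^ 2 / (k / Real.pi)) = Real.pi * ‖z‖ ^ 2 := by
    field_simp
  rwa [this]

theorem norm_gabor_hermiteS_ridge {k : ℕ} (hk : 1 ≤ k) :
    ‖gabor (hermiteS k : 𝓢'(ℝ, ℂ)) ((Real.sqrt (k / Real.pi) : ℝ) : ℂ).re
      ((Real.sqrt (k / Real.pi) : ℝ) : ℂ).im‖ = hermitePeak k := by
  have hk' : (0 : ℝ) < k := by exact_mod_cast hk
  have hρ0 : 0 < Real.sqrt (k / Real.pi) := by positivity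
  rw [norm_gabor_hermiteS_eq_peak_mul hk, Complex.norm_real, Real.norm_of_nonneg hρ0.le,
    div_self hρ0.ne', sub_self, decayRatio_zero, mul_one]

theorem bddAbove_norm_gabor_hermiteS {k : ℕ} (hk : 1 ≤ k) :
    BddAbove (Set.range fun p : ℝ × ℝ => ‖gabor (hermiteS k : 𝓢'(ℝ, ℂ)) p.1 p.2‖) := by
  refine ⟨hermitePeak k, ?_⟩
  rintro _ ⟨p, rfl⟩
  exact norm_gabor_hermiteS_le_peak hk ⟨p.1, p.2⟩

theorem minimaxM_le_peak {k l : ℕ} (hk : 1 ≤ k) (hkl : k ≤ l) : minimaxM l ≤ hermitePeak k := by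
  refine (ciInf_le (Set.finite_range _).bddBelow (⟨k, hk, hkl⟩ : Set.Icc 1 l)).trans ?_
  exact ciSup_le fun p => norm_gabor_hermiteS_le_peak hk ⟨p.1, p.2⟩

theorem minimaxM_pos {l : ℕ} (hl : 1 ≤ l) : 0 < minimaxM l := by
  have : Nonempty (Set.Icc 1 l) := ⟨⟨1, le_rfl, hl⟩⟩
  obtain ⟨k, hk⟩ := exists_eq_ciInf_of_finite
    (f := fun k : Set.Icc 1 l => ⨆ p : ℝ × ℝ, ‖gabor (hermiteS k : 𝓢'(ℝ, ℂ)) p.1 p.2‖)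
  rw [minimaxM, ← hk]
  refine (hermitePeak_pos k.2.1).trans_le ?_
  rw [← norm_gabor_hermiteS_ridge k.2.1]
  exact le_ciSup (bddAbove_norm_gabor_hermiteS k.2.1) (_, _)

theorem iSup_betaConst_lt_one {l : ℕ} (hl : 1 ≤ l) : ⨆ k : Set.Icc 1 l, betaConst k < 1 := by
  have : Nonempty (Set.Icc 1 l) := ⟨⟨1, le_rfl, hl⟩⟩
  obtain ⟨k, hk⟩ := exists_eq_ciSup_of_finite (f := fun k : Set.Icc 1 l => betaConst k)
  rw [← hk]
  exact betaConst_lt_one k.2.1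

/-! ### The estimator of the mode -/

theorem isCompact_box (L : ℝ) : IsCompact (box L) := by
  refine Metric.isCompact_of_isClosed_isBounded ?_ ?_
  · exact isClosed_le (by fun_prop) continuous_const
  · refine (Metric.isBounded_closedBall (x := (0 : ℂ)) (r := 2 * L)).subset fun z hz => ?_
    obtain ⟨h1, h2⟩ := max_le_iff.mp (show max |z.re| |z.im| ≤ L from hz)
    rw [mem_closedBall_zero_iff]
    linarith [Complex.norm_le_abs_re_add_abs_im z]

/-- If the maximizers of the spectrogram all lie close to the circle of radius `√(m/π)`, then
`k̂ = m`. -/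
theorem isKHat_of_forall_far_lt {L : ℝ} {y : 𝓢'(ℝ, ℂ)} {m : ℤ} {w : ℂ} (hw : w ∈ box L)
    (h : ∀ z ∈ box L, 1 / 2 ≤ |Real.pi * ‖z‖ ^ 2 - m| →
      ‖gabor y z.re z.im‖ < ‖gabor y w.re w.im‖) : IsKHat L y m := by
  have hc := (continuous_gabor y).norm
  obtain ⟨z₁, hz₁, hmax⟩ := (isCompact_box L).exists_isMaxOn ⟨w, hw⟩ hc.continuousOn
  have hlc : IsCompact (levelSet L y ‖gabor y z₁.re z₁.im‖) :=
    (isCompact_box L).inter_right (isClosed_le continuous_const hc)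
  obtain ⟨z₂, hz₂, hmin⟩ := hlc.exists_isMinOn ⟨z₁, hz₁, le_rfl⟩ continuous_norm.continuousOn
  refine ⟨‖gabor y z₁.re z₁.im‖, ‖z₂‖, ⟨⟨⟨z₁, hz₁, le_rfl⟩, norm_nonneg _⟩, ?_⟩,
    ⟨⟨z₂, hz₂, rfl⟩, ?_⟩, ?_⟩
  · rintro θ ⟨⟨z, hz, hθ⟩, -⟩
    exact hθ.trans (hmax hz)
  · rintro _ ⟨z, hz, rfl⟩
    exact hmin hz
  · have hnear : |Real.pi * ‖z₂‖ ^ 2 - m| < 1 / 2 := by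
      by_contra! hfar
      have h1 := h z₂ hz₂.1 hfar
      have h2 : ‖gabor y w.re w.im‖ ≤ ‖gabor y z₁.re z₁.im‖ := hmax hw
      exact absurd (h2.trans hz₂.2) (not_le.mpr h1)
    rw [abs_lt] at hnear
    rw [eq_comm, round_eq, Int.floor_eq_iff]
    constructor <;> linarith

theorem isKHat_hermite_add {k k₀ : ℕ} {L S lam : ℝ} {η : 𝓢'(ℝ, ℂ)} (hk : 1 ≤ k) (hkk : k ≤ k₀)
    (hL : Real.sqrt (k₀ / Real.pi) ≤ L) (hS : 0 < S)
    (hη : ∀ z ∈ box L, ‖gabor η z.re z.im‖ ≤ S)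
    (hlam : 5 * modeConst k₀ * S * (minimaxM k₀)⁻¹ ≤ |lam|) :
    IsKHat L ((lam : ℂ) • (hermiteS k : 𝓢'(ℝ, ℂ)) + η) k := by
  set B := ⨆ k : Set.Icc 1 k₀, betaConst k with hB
  have hB1 : B < 1 := iSup_betaConst_lt_one (hk.trans hkk)
  have hkB : betaConst k ≤ B :=
    le_ciSup (f := fun k : Set.Icc 1 k₀ => betaConst k) (Set.finite_range _).bddAbove ⟨k, hk, hkk⟩
  have hM := minimaxM_pos (hk.trans hkk)
  have hP := hermitePeak_pos hk
  have hbig : 2 * S < |lam| * hermitePeak k * (1 - B) := by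
    rw [mul_inv_le_iff₀ hM] at hlam
    have h1 : |lam| * minimaxM k₀ ≤ |lam| * hermitePeak k := by
      gcongr
      exact minimaxM_le_peak hk hkk
    have h2 : 5 * modeConst k₀ * S * (1 - B) ≤ |lam| * hermitePeak k * (1 - B) :=
      mul_le_mul_of_nonneg_right (hlam.trans h1) (by linarith)
    -- The first term of `modeConst` produces exactly the gap `2 * S`; its summand `+ 1` makes the
    -- inequality strict.
    have h3 : 5 * modeConst k₀ * S * (1 - B) = 2 * S + 5 * (1 - B) * S := by
      have : 1 - B ≠ 0 := by linarith
      rw [modeConst, ← hB]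
      field_simp
    have h4 : 0 < 5 * (1 - B) * S := mul_pos (by linarith) hS
    linarith
  have hgab : ∀ z : ℂ, gabor ((lam : ℂ) • (hermiteS k : 𝓢'(ℝ, ℂ)) + η) z.re z.im =
      lam * gabor (hermiteS k : 𝓢'(ℝ, ℂ)) z.re z.im + gabor η z.re z.im := fun z => rfl
  have hw : ((Real.sqrt (k / Real.pi) : ℝ) : ℂ) ∈ box L := by
    have h1 : Real.sqrt (k / Real.pi) ≤ L := by
      refine le_trans (Real.sqrt_le_sqrt ?_) hL
      gcongr
    change max |_| |_| ≤ L
    rw [Complex.ofReal_re, Complex.ofReal_im, abs_zero, abs_of_nonneg (Real.sqrt_nonneg _)]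
    exact max_le h1 ((Real.sqrt_nonneg _).trans h1)
  refine isKHat_of_forall_far_lt hw fun z hz hfar => ?_
  have h1 : ‖gabor ((lam : ℂ) • (hermiteS k : 𝓢'(ℝ, ℂ)) + η) z.re z.im‖ ≤
      |lam| * hermitePeak k * B + S := by
    rw [hgab]
    refine (norm_add_le _ _).trans (add_le_add ?_ (hη z hz))
    rw [norm_mul, Complex.norm_real, Real.norm_eq_abs, mul_assoc]
    refine mul_le_mul_of_nonneg_left ?_ (abs_nonneg _)
    refine (norm_gabor_hermiteS_le_of_far hk (by exact_mod_cast hfar)).trans ?_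
    gcongr
  have h2 : |lam| * hermitePeak k - S ≤ ‖gabor ((lam : ℂ) • (hermiteS k : 𝓢'(ℝ, ℂ)) + η)
      ((Real.sqrt (k / Real.pi) : ℝ) : ℂ).re ((Real.sqrt (k / Real.pi) : ℝ) : ℂ).im‖ := by
    rw [hgab]
    refine le_trans ?_ (norm_sub_le_norm_add _ _)
    rw [norm_mul, Complex.norm_real, Real.norm_eq_abs, norm_gabor_hermiteS_ridge hk]
    linarith [hη _ hw]
  linarith

end

theorem theorem4 :
    ∃ K : ℝ, 0 < K ∧
      ∀ (μ : Measure 𝓢'(ℝ, ℂ)) [IsProbabilityMeasure μ], IsWhiteNoise μ →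
      ∀ σ : ℝ, 0 < σ → σ ≤ Real.sqrt Real.pi →
        (∀ L τ : ℝ, Real.pi ≤ L → 0 < τ →
          1 - 4 * Real.exp (-(τ ^ 2 / (2 * Real.pi) * Real.log L)) ≤
            μ.real {ξ | ∀ z ∈ box L, ‖gabor ((σ : ℂ) • ξ) z.re z.im‖ ≤
              Real.sqrt 2 * (14 * K + τ) * Real.sqrt (Real.log L)}) ∧
        (∀ (k₀ : ℕ) (L τ lam : ℝ), 1 ≤ k₀ →
          max (Real.sqrt (k₀ / Real.pi)) Real.pi ≤ L → 0 < τ →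
          5 * modeConst k₀ * Real.sqrt 2 * (14 * K + τ) * (minimaxM k₀)⁻¹ *
            Real.sqrt (Real.log L) ≤ |lam| →
          ∀ k : ℕ, 1 ≤ k → k ≤ k₀ →
            1 - 4 * Real.exp (-(τ ^ 2 / (2 * Real.pi) * Real.log L)) ≤
              μ.real {ξ | IsKHat L ((lam : ℂ) • (hermiteS k : 𝓢'(ℝ, ℂ)) + (σ : ℂ) • ξ) k}) := by
  refine ⟨1, one_pos, fun μ _ hμ σ hσ hσ' => ?_⟩
  simp only [mul_one]
  refine ⟨fun L τ hL hτ =>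
    hμ.le_measureReal_forall_gabor_le hσ.le hσ' hL hτ, ?_⟩
  intro k₀ L τ lam _ hL hτ hlam k hk hkk
  have hπL : Real.pi ≤ L := (le_max_right _ _).trans hL
  refine (hμ.le_measureReal_forall_gabor_le hσ.le hσ' hπL hτ).trans
    (measureReal_mono fun ξ hξ => ?_)
  have hlog : 0 < Real.log L := Real.log_pos (by linarith [Real.pi_gt_three])
  refine isKHat_hermite_add hk hkk ((le_max_left _ _).trans hL)
    (S := Real.sqrt 2 * (14 + τ) * Real.sqrt (Real.log L)) (by positivity) hξ ?_
  refine le_trans (le_of_eq ?_) hlam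
  ring
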